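/- Let $p$ be a prime, $n\ge 0$, and let $$\mathbf F=\frac{\mathbb F_p\{x_1,\dots,x_n,F\}}{(x_ix_j-x_jx_i,\ x_i^pF-Fx_i\mid 1\le i,j\le n)}$$ be the ring of Frobenius operators over $\mathbb F_p[x_1,\dots,x_n]$. Let $\mathcal B$ be the Bernstein filtration on $\mathbf F$: $\mathcal B_i$ is the $\mathbb F_p$-span of all products of at most $i$ of the symbols $x_1,\dots,x_n,F$ (and $\mathcal B_{-1}=0$). Let $\mathbf A=\mathrm{gr}_{\mathcal B}(\mathbf F)=\bigoplus_{i\ge 0}\mathcal B_i/\mathcal B_{i-1}$. A $\mathcal B$-compatible filtration on a left $\mathbf F$-module $M$ is a chain $\Omega_0\subseteq\Omega_1\subseteq\cdots$ of $\mathbb F_p$-subspaces of $M$ with $\bigcup_i\Omega_i=M$ and $\mathcal B_i\Omega_j\subseteq\Omega_{i+j}$ for all $i,j\ge0$; put $\Omega_i=0$ for $i<0$. It is called great if every $\Omega_i$ is finite-dimensional over $\mathbb F_p$ and $\mathrm{gr}_\Omega(M)=\bigoplus_{i\ge0}\Omega_i/\Omega_{i-1}$ is a finitely presented left $\mathbf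 A$-module. If $A$ and $B$ are $\mathcal B$-compatible filtrations on $M$ and $g\in\mathbb N$ is such that $A_i\subseteq B_i\subseteq A_{i+g}$ for all $i$, define for $0\le k\le g$ the $\mathbf A$-modules $$\mathrm{gr}^k_{A,B}(M)=\bigoplus_{i\ge0}\frac{A_{i+k}\cap B_i}{A_{i+k-1}\cap B_i+A_{i+k}\cap B_{i-1}},\qquad U^k_{A,B}=\bigoplus_{i\ge0}\frac{A_i\cap B_{i+k-g}}{A_{i-1}\cap B_{i+k-g}},\qquad V^k_{A,B}=\bigoplus_{i\ge0}\frac{A_{i+k}\cap B_i}{A_{i+k}\cap B_{i-1}},$$ where the class in $\mathcal B_l/\mathcal B_{l-1}$ of $t\in\mathcal B_l$ sends the class of $m$ in the $i$-th summand to the class of $tm$ in the $(i+l)$-th summand. Theorem. Let $M$ be a left $\mathbf F$-module, let $\Sigma$ and $\Omega$ be great $\mathcal B$-compatible filtrations on $M$, and let $w\in\mathbb N$ be such that $\Sigma_i\subseteq\Omega_i\subseteq\Sigma_{i+w}$ for all $i\ge 0$. For $0\le a\le w$ let $T^a$ be the interpolating filtration $T^a_i=\Sigma_{i+a}\cap\Omega_i$.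 Then each $T^a$ with $0\le a\le w$ is a great filtration. Moreover, for all $0\le a\le b\le w$ and all $0\le k\le b-a$, the modules $\mathrm{gr}^k_{T^a,T^b}(M)$, $U^k_{T^a,T^b}$ and $V^k_{T^a,T^b}$ (formed with $g=b-a$, which is admissible since $T^a_i\subseteq T^b_i\subseteq T^a_{i+(b-a)}$) are finitely presented over $\mathbf A$. -/

import Mathlib

open scoped DirectSum

namespace FrobFilt

/-! ### Filtrations indexed by the natural numbers -/

/-- Extension of an `ℕ`-indexed family of subspaces to `ℤ`, with value `0` in negative degrees. -/
def zext {K M : Type*} [CommRing K] [AddCommGroup M] [Module K M]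
    (P : ℕ → Submodule K M) : ℤ → Submodule K M
  | Int.ofNat i => P i
  | Int.negSucc _ => ⊥

/-- An exhaustive `ℕ`-filtration of a (not necessarily commutative) `K`-algebra `R`. -/
structure RingFiltration (K R : Type*) [CommRing K] [Ring R] [Algebra K R] where
  /-- the `i`-th piece of the filtration -/
  piece : ℕ → Submodule K R
  mono : ∀ {i j : ℕ}, i ≤ j → piece i ≤ piece j
  exhaustive : ∀ x : R, ∃ i, x ∈ piece i
  one_mem : (1 : R) ∈ piece 0
  mul_mem : ∀ {i j : ℕ} {x y : R}, x ∈ piece i → y ∈ piece j → x * y ∈ piece (i + j)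

/-- An exhaustive `ℕ`-filtration of a left `R`-module, compatible with a filtration of `R`. -/
structure ModuleFiltration {K R : Type*} [CommRing K] [Ring R] [Algebra K R]
    (W : RingFiltration K R) (M : Type*) [AddCommGroup M] [Module K M] [Module R M] where
  /-- the `i`-th piece of the filtration -/
  piece : ℕ → Submodule K M
  mono : ∀ {i j : ℕ}, i ≤ j → piece i ≤ piece j
  exhaustive : ∀ m : M, ∃ i, m ∈ piece i
  smul_mem : ∀ {i j : ℕ} {x : R} {m : M}, x ∈ W.piece i → m ∈ piece j → x • m ∈ piece (i + j)

/-- Subspaces `low i ⊆ high i` of an `R`-module `M` such that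
`W_k · high_i ⊆ high_{k+i}`, `W_k · low_i ⊆ low_{k+i}` and `W_{k-1} · high_i ⊆ low_{k+i}`.
These are exactly the conditions under which `[x]_k · [m]_i = [x m]_{k+i}` is well defined on
`⨁ i, high_i / low_i`, for `[x]_k` the class in `W_k / W_{k-1}` of an element of `W_k`. -/
structure Subquotients {K R : Type*} [CommRing K] [Ring R] [Algebra K R]
    (W : RingFiltration K R) (M : Type*) [AddCommGroup M] [Module K M] [Module R M] where
  /-- the numerators -/
  high : ℕ → Submodule K M
  /-- the denominators -/
  low : ℕ → Submodule K M
  low_le_high : ∀ i, low i ≤ high i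
  smul_high : ∀ {k i : ℕ} {x : R} {m : M}, x ∈ W.piece k → m ∈ high i → x • m ∈ high (k + i)
  smul_low : ∀ {k i : ℕ} {x : R} {m : M}, x ∈ W.piece k → m ∈ low i → x • m ∈ low (k + i)
  prev_smul_high : ∀ {k i : ℕ} {x : R} {m : M},
    x ∈ zext W.piece ((k : ℤ) - 1) → m ∈ high i → x • m ∈ low (k + i)

section Basic

variable {K R M : Type*} [CommRing K] [Ring R] [Algebra K R]
  [AddCommGroup M] [Module K M] [Module R M]

lemma zext_natCast (P : ℕ → Submodule K M) (i : ℕ) : zext P (i : ℤ) = P i := rfl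

lemma zext_of_neg (P : ℕ → Submodule K M) {a : ℤ} (h : a < 0) : zext P a = ⊥ := by
  cases a with
  | ofNat i => simp at h; omega
  | negSucc i => rfl

lemma zext_mono {P : ℕ → Submodule K M} (hP : ∀ {i j : ℕ}, i ≤ j → P i ≤ P j)
    {a b : ℤ} (h : a ≤ b) : zext P a ≤ zext P b := by
  rcases lt_or_ge a 0 with ha | ha
  · rw [zext_of_neg P ha]; exact bot_le
  · lift a to ℕ using ha
    lift b to ℕ using by omega
    exact hP (by exact_mod_cast h)

lemma RingFiltration.mul_mem_zext (W : RingFiltration K R) {a b c : ℤ} {x y : R}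
    (hx : x ∈ zext W.piece a) (hy : y ∈ zext W.piece b) (h : a + b = c) :
    x * y ∈ zext W.piece c := by
  subst h
  rcases lt_or_ge a 0 with ha | ha
  · rw [zext_of_neg _ ha, Submodule.mem_bot] at hx
    simp [hx]
  rcases lt_or_ge b 0 with hb | hb
  · rw [zext_of_neg _ hb, Submodule.mem_bot] at hy
    simp [hy]
  lift a to ℕ using ha
  lift b to ℕ using hb
  exact W.mul_mem hx hy

lemma ModuleFiltration.smul_mem_zext {W : RingFiltration K R} (A : ModuleFiltration W M)
    {a b c : ℤ} {x : R} {m : M}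
    (hx : x ∈ zext W.piece a) (hm : m ∈ zext A.piece b) (h : a + b = c) :
    x • m ∈ zext A.piece c := by
  subst h
  rcases lt_or_ge a 0 with ha | ha
  · rw [zext_of_neg _ ha, Submodule.mem_bot] at hx
    simp [hx]
  rcases lt_or_ge b 0 with hb | hb
  · rw [zext_of_neg _ hb, Submodule.mem_bot] at hm
    simp [hm]
  lift a to ℕ using ha
  lift b to ℕ using hb
  exact A.smul_mem hx hm

namespace Subquotients

variable {W : RingFiltration K R}

/-- The `i`-th graded component `high_i / low_i`. -/
abbrev Comp (S : Subquotients W M) (i : ℕ) : Type _ :=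
  ↥(S.high i) ⧸ (S.low i).submoduleOf (S.high i)

/-- The class `[m]_i` of an element of `high_i`. -/
def cls (S : Subquotients W M) (i : ℕ) (m : M) (hm : m ∈ S.high i) : S.Comp i :=
  Submodule.Quotient.mk ⟨m, hm⟩

/-- The direct sum `⨁ i, high_i / low_i`. -/
def Total (S : Subquotients W M) : Type _ := ⨁ i : ℕ, S.Comp i

instance (S : Subquotients W M) : AddCommGroup S.Total :=
  inferInstanceAs (AddCommGroup (⨁ i : ℕ, S.Comp i))

lemma cls_eq_cls (S : Subquotients W M) {i : ℕ} {m m' : M} {hm : m ∈ S.high i}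
    {hm' : m' ∈ S.high i} : S.cls i m hm = S.cls i m' hm' ↔ m - m' ∈ S.low i := by
  unfold cls
  rw [Submodule.Quotient.eq]
  rfl

lemma exists_cls (S : Subquotients W M) {i : ℕ} (a : S.Comp i) :
    ∃ (m : M) (hm : m ∈ S.high i), a = S.cls i m hm := by
  obtain ⟨⟨m, hm⟩, rfl⟩ := Submodule.Quotient.mk_surjective _ a
  exact ⟨m, hm, rfl⟩

lemma gradedMk_congr (S : Subquotients W M) {i j : ℕ} {m m' : M} {hm : m ∈ S.high i}
    {hm' : m' ∈ S.high j} (hij : i = j) (h : m = m') :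
    (GradedMonoid.mk i (S.cls i m hm) : GradedMonoid S.Comp) = GradedMonoid.mk j (S.cls j m' hm') := by
  subst hij
  subst h
  rfl

end Subquotients

/-- The subquotients `W_i / W_{i-1}` of the filtered ring itself. -/
def RingFiltration.self (W : RingFiltration K R) : Subquotients W R where
  high := W.piece
  low i := zext W.piece ((i : ℤ) - 1)
  low_le_high i := zext_mono (b := (i : ℤ)) W.mono (by omega)
  smul_high hx hm := W.mul_mem hx hm
  smul_low {k i _ _} hx hm := W.mul_mem_zext (a := (k : ℤ)) hx hm (by push_cast; ring)
  prev_smul_high {k i _ _} hx hm := W.mul_mem_zext (b := (i : ℤ)) hx hm (by push_cast; ring)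

/-- The product `[x]_k · [m]_i = [x m]_{k+i}`. -/
def Subquotients.smulComp {W : RingFiltration K R} (S : Subquotients W M) {k i : ℕ}
    (a : W.self.Comp k) (b : S.Comp i) : S.Comp (k + i) :=
  Quotient.liftOn₂ a b
    (fun x m => S.cls (k + i) ((x : R) • (m : M)) (S.smul_high x.2 m.2))
    (by
      intro x m x' m' hx hm
      have h1 : (x : R) - (x' : R) ∈ zext W.piece ((k : ℤ) - 1) :=
        (Submodule.quotientRel_def ((zext W.piece ((k : ℤ) - 1)).submoduleOf (W.piece k))).mp hx
      have h2 : (m : M) - (m' : M) ∈ S.low i := (Submodule.quotientRel_def ((S.low i).submoduleOf (S.high i))).mp hm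
      refine S.cls_eq_cls.mpr ?_
      have h3 : (x : R) • (m : M) - (x' : R) • (m' : M)
          = ((x : R) - (x' : R)) • (m : M) + (x' : R) • ((m : M) - (m' : M)) := by
        rw [sub_smul, smul_sub]; abel
      rw [h3]
      exact Submodule.add_mem _ (S.prev_smul_high h1 m.2) (S.smul_low x'.2 h2))

lemma Subquotients.smulComp_cls {W : RingFiltration K R} (S : Subquotients W M) {k i : ℕ}
    {x : R} {m : M} (hx : x ∈ W.self.high k) (hm : m ∈ S.high i) :
    S.smulComp (W.self.cls k x hx) (S.cls i m hm) = S.cls (k + i) (x • m) (S.smul_high hx hm) := rfl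

lemma Subquotients.smulComp_add {W : RingFiltration K R} (S : Subquotients W M) {k i : ℕ}
    (a : W.self.Comp k) (b c : S.Comp i) :
    S.smulComp a (b + c) = S.smulComp a b + S.smulComp a c := by
  obtain ⟨x, hx, rfl⟩ := W.self.exists_cls a
  obtain ⟨m, hm, rfl⟩ := S.exists_cls b
  obtain ⟨m', hm', rfl⟩ := S.exists_cls c
  refine S.cls_eq_cls (hm := S.smul_high hx (add_mem hm hm'))
    (hm' := add_mem (S.smul_high hx hm) (S.smul_high hx hm')) |>.mpr ?_
  simp [smul_add]

lemma Subquotients.add_smulComp {W : RingFiltration K R} (S : Subquotients W M) {k i : ℕ}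
    (a b : W.self.Comp k) (c : S.Comp i) :
    S.smulComp (a + b) c = S.smulComp a c + S.smulComp b c := by
  obtain ⟨x, hx, rfl⟩ := W.self.exists_cls a
  obtain ⟨x', hx', rfl⟩ := W.self.exists_cls b
  obtain ⟨m, hm, rfl⟩ := S.exists_cls c
  refine S.cls_eq_cls (hm := S.smul_high (add_mem (S := Submodule K R) hx hx') hm)
    (hm' := add_mem (S.smul_high hx hm) (S.smul_high hx' hm)) |>.mpr ?_
  simp [add_smul]

lemma Subquotients.smulComp_zero {W : RingFiltration K R} (S : Subquotients W M) {k i : ℕ}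
    (a : W.self.Comp k) : S.smulComp a (0 : S.Comp i) = 0 := by
  have h := S.smulComp_add a (0 : S.Comp i) 0
  simpa using h

lemma Subquotients.zero_smulComp {W : RingFiltration K R} (S : Subquotients W M) {k i : ℕ}
    (b : S.Comp i) : S.smulComp (0 : W.self.Comp k) b = 0 := by
  have h := S.add_smulComp (0 : W.self.Comp k) 0 b
  simpa using h

lemma RingFiltration.algebraMap_mem (W : RingFiltration K R) (c : K) :
    algebraMap K R c ∈ W.piece 0 := by
  rw [Algebra.algebraMap_eq_smul_one]
  exact Submodule.smul_mem _ _ W.one_mem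

lemma RingFiltration.natCast_mem (W : RingFiltration K R) (n : ℕ) : (n : R) ∈ W.piece 0 := by
  simpa using W.algebraMap_mem (n : K)

lemma RingFiltration.intCast_mem (W : RingFiltration K R) (n : ℤ) : (n : R) ∈ W.piece 0 := by
  simpa using W.algebraMap_mem (n : K)

/-- The unit `[1]_0`. -/
instance RingFiltration.gOne (W : RingFiltration K R) : GradedMonoid.GOne W.self.Comp where
  one := W.self.cls 0 1 W.one_mem

/-- The graded multiplication `[x]_i · [y]_j = [x y]_{i+j}`. -/
instance RingFiltration.gMul (W : RingFiltration K R) : GradedMonoid.GMul W.self.Comp where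
  mul a b := W.self.smulComp a b

instance RingFiltration.gMonoid (W : RingFiltration K R) : GradedMonoid.GMonoid W.self.Comp where
  one_mul := by
    rintro ⟨i, a⟩
    obtain ⟨x, hx, rfl⟩ := W.self.exists_cls a
    exact W.self.gradedMk_congr (zero_add i) (one_mul x)
  mul_one := by
    rintro ⟨i, a⟩
    obtain ⟨x, hx, rfl⟩ := W.self.exists_cls a
    exact W.self.gradedMk_congr (add_zero i) (mul_one x)
  mul_assoc := by
    rintro ⟨i, a⟩ ⟨j, b⟩ ⟨k, c⟩
    obtain ⟨x, hx, rfl⟩ := W.self.exists_cls a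
    obtain ⟨y, hy, rfl⟩ := W.self.exists_cls b
    obtain ⟨z, hz, rfl⟩ := W.self.exists_cls c
    exact W.self.gradedMk_congr (add_assoc i j k) (mul_assoc x y z)

instance RingFiltration.gRing (W : RingFiltration K R) : DirectSum.GRing W.self.Comp where
  __ := W.gMonoid
  mul_zero a := W.self.smulComp_zero a
  zero_mul b := W.self.zero_smulComp b
  mul_add a b c := W.self.smulComp_add a b c
  add_mul a b c := W.self.add_smulComp a b c
  natCast n := W.self.cls 0 n (W.natCast_mem n)
  natCast_zero := W.self.cls_eq_cls (hm' := zero_mem _) |>.mpr (by simp)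
  natCast_succ n := W.self.cls_eq_cls (hm' := add_mem (W.natCast_mem n) W.one_mem) |>.mpr (by simp)
  intCast n := W.self.cls 0 n (W.intCast_mem n)
  intCast_ofNat n := W.self.cls_eq_cls.mpr (by simp)
  intCast_negSucc_ofNat n :=
    W.self.cls_eq_cls (hm' := neg_mem (W.natCast_mem (n + 1))) |>.mpr (by simp)

/-- The associated graded ring `⨁ i, W_i / W_{i-1}`. -/
def RingFiltration.Gr (W : RingFiltration K R) : Type _ := ⨁ i : ℕ, W.self.Comp i

instance (W : RingFiltration K R) : Ring W.Gr :=
  inferInstanceAs (Ring (⨁ i : ℕ, W.self.Comp i))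

/-- The graded action of the associated graded ring: `[x]_k · [m]_i = [x m]_{k+i}`. -/
instance Subquotients.gmodule {W : RingFiltration K R} (S : Subquotients W M) :
    DirectSum.Gmodule W.self.Comp S.Comp where
  smul a b := S.smulComp a b
  smul_add a b c := S.smulComp_add a b c
  smul_zero a := S.smulComp_zero a
  add_smul a b c := S.add_smulComp a b c
  zero_smul b := S.zero_smulComp b
  one_smul := by
    rintro ⟨i, a⟩
    obtain ⟨x, hx, rfl⟩ := S.exists_cls a
    exact S.gradedMk_congr (zero_add i) (one_smul R x)
  mul_smul := by
    rintro ⟨i, a⟩ ⟨j, b⟩ ⟨k, c⟩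
    obtain ⟨x, hx, rfl⟩ := W.self.exists_cls a
    obtain ⟨y, hy, rfl⟩ := W.self.exists_cls b
    obtain ⟨z, hz, rfl⟩ := S.exists_cls c
    exact S.gradedMk_congr (add_assoc i j k) (mul_smul x y z)

/-- `⨁ i, high_i / low_i` as a left module over the associated graded ring. -/
instance {W : RingFiltration K R} (S : Subquotients W M) : Module W.Gr S.Total :=
  inferInstanceAs (Module (⨁ i : ℕ, W.self.Comp i) (⨁ i : ℕ, S.Comp i))

/-- The total space `⨁ i, high_i / low_i` is finitely presented over the associated graded ring. -/
def Subquotients.IsFinitelyPresented {W : RingFiltration K R} (S : Subquotients W M) : Prop :=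
  Module.FinitePresentation W.Gr S.Total

namespace ModuleFiltration

variable {W : RingFiltration K R}

/-- `gr_A(M) = ⨁ i, A_i / A_{i-1}`. -/
def gr (A : ModuleFiltration W M) : Subquotients W M where
  high := A.piece
  low i := zext A.piece ((i : ℤ) - 1)
  low_le_high i := zext_mono (b := (i : ℤ)) A.mono (by omega)
  smul_high hx hm := A.smul_mem hx hm
  smul_low {k i _ _} hx hm := A.smul_mem_zext (a := (k : ℤ)) hx hm (by push_cast; ring)
  prev_smul_high {k i _ _} hx hm := A.smul_mem_zext (b := (i : ℤ)) hx hm (by push_cast; ring)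

/-- A filtration is great if its pieces are finite-dimensional and its associated graded module
is finitely presented over the associated graded ring. -/
def IsGreat (A : ModuleFiltration W M) : Prop :=
  (∀ i, Module.Finite K ↥(A.piece i)) ∧ A.gr.IsFinitelyPresented

/-- The filtration `T^a` given by `T^a_i = A_{i+a} ∩ B_i`. -/
def interpolating (A B : ModuleFiltration W M) (a : ℕ) : ModuleFiltration W M where
  piece i := A.piece (i + a) ⊓ B.piece i
  mono h := inf_le_inf (A.mono (by omega)) (B.mono h)
  exhaustive m := by
    obtain ⟨i, hi⟩ := A.exhaustive m
    obtain ⟨j, hj⟩ := B.exhaustive m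
    exact ⟨i + j, A.mono (by omega) hi, B.mono (by omega) hj⟩
  smul_mem {i j _ _} hx hm := by
    refine ⟨?_, B.smul_mem hx hm.2⟩
    rw [add_assoc]
    exact A.smul_mem hx hm.1

/-- `gr^k_{A,B}(M) = ⨁ i, (A_{i+k} ∩ B_i) / (A_{i+k-1} ∩ B_i + A_{i+k} ∩ B_{i-1})`. -/
def grDiag (A B : ModuleFiltration W M) (k : ℕ) : Subquotients W M where
  high i := zext A.piece ((i : ℤ) + k) ⊓ zext B.piece (i : ℤ)
  low i := (zext A.piece ((i : ℤ) + k - 1) ⊓ zext B.piece (i : ℤ)) ⊔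
    (zext A.piece ((i : ℤ) + k) ⊓ zext B.piece ((i : ℤ) - 1))
  low_le_high i := sup_le (inf_le_inf (zext_mono A.mono (by omega)) le_rfl)
    (inf_le_inf le_rfl (zext_mono B.mono (by omega)))
  smul_high {l i _ _} hx hm :=
    ⟨A.smul_mem_zext (a := (l : ℤ)) hx hm.1 (by push_cast; ring),
      B.smul_mem_zext (a := (l : ℤ)) hx hm.2 (by push_cast; ring)⟩
  smul_low {l i x m} hx hm := by
    obtain ⟨u, hu, v, hv, rfl⟩ := Submodule.mem_sup.mp hm
    rw [smul_add]
    refine Submodule.add_mem_sup ⟨?_, ?_⟩ ⟨?_, ?_⟩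
    · exact A.smul_mem_zext (a := (l : ℤ)) hx hu.1 (by push_cast; ring)
    · exact B.smul_mem_zext (a := (l : ℤ)) hx hu.2 (by push_cast; ring)
    · exact A.smul_mem_zext (a := (l : ℤ)) hx hv.1 (by push_cast; ring)
    · exact B.smul_mem_zext (a := (l : ℤ)) hx hv.2 (by push_cast; ring)
  prev_smul_high {l i x m} hx hm := by
    refine Submodule.mem_sup_left ⟨A.smul_mem_zext hx hm.1 (by push_cast; ring), ?_⟩
    exact zext_mono B.mono (by push_cast; omega) (B.smul_mem_zext hx hm.2 rfl)

/-- `V^k_{A,B} = ⨁ i, (A_{i+k} ∩ B_i) / (A_{i+k} ∩ B_{i-1})`. -/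
def V (A B : ModuleFiltration W M) (k : ℕ) : Subquotients W M where
  high i := zext A.piece ((i : ℤ) + k) ⊓ zext B.piece (i : ℤ)
  low i := zext A.piece ((i : ℤ) + k) ⊓ zext B.piece ((i : ℤ) - 1)
  low_le_high i := inf_le_inf le_rfl (zext_mono B.mono (by omega))
  smul_high {l i _ _} hx hm :=
    ⟨A.smul_mem_zext (a := (l : ℤ)) hx hm.1 (by push_cast; ring),
      B.smul_mem_zext (a := (l : ℤ)) hx hm.2 (by push_cast; ring)⟩
  smul_low {l i _ _} hx hm :=
    ⟨A.smul_mem_zext (a := (l : ℤ)) hx hm.1 (by push_cast; ring),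
      B.smul_mem_zext (a := (l : ℤ)) hx hm.2 (by push_cast; ring)⟩
  prev_smul_high {l i _ _} hx hm :=
    ⟨zext_mono A.mono (by push_cast; omega) (A.smul_mem_zext hx hm.1 rfl),
      B.smul_mem_zext hx hm.2 (by push_cast; ring)⟩

/-- `U^k_{A,B} = ⨁ i, (A_i ∩ B_{i+k-g}) / (A_{i-1} ∩ B_{i+k-g})`, where `g` is a natural number
with `A_i ⊆ B_i ⊆ A_{i+g}` for all `i`. -/
def U (A B : ModuleFiltration W M) (g k : ℕ) : Subquotients W M where
  high i := zext A.piece (i : ℤ) ⊓ zext B.piece ((i : ℤ) + k - g)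
  low i := zext A.piece ((i : ℤ) - 1) ⊓ zext B.piece ((i : ℤ) + k - g)
  low_le_high i := inf_le_inf (zext_mono A.mono (by omega)) le_rfl
  smul_high {l i _ _} hx hm :=
    ⟨A.smul_mem_zext (a := (l : ℤ)) hx hm.1 (by push_cast; ring),
      B.smul_mem_zext (a := (l : ℤ)) hx hm.2 (by push_cast; ring)⟩
  smul_low {l i _ _} hx hm :=
    ⟨A.smul_mem_zext (a := (l : ℤ)) hx hm.1 (by push_cast; ring),
      B.smul_mem_zext (a := (l : ℤ)) hx hm.2 (by push_cast; ring)⟩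
  prev_smul_high {l i _ _} hx hm :=
    ⟨A.smul_mem_zext hx hm.1 (by push_cast; ring),
      zext_mono B.mono (by push_cast; omega) (B.smul_mem_zext hx hm.2 rfl)⟩

end ModuleFiltration

end Basic

/-! ### The ring of Frobenius operators and its Bernstein filtration -/

/-- The letters `x_1, …, x_n, F`. -/
inductive Letter (n : ℕ) : Type
  | x (i : Fin n)
  | F

/-- The relations `x_i x_j = x_j x_i` and `x_i ^ p F = F x_i`. -/
inductive FrobRel (p n : ℕ) :
    FreeAlgebra (ZMod p) (Letter n) → FreeAlgebra (ZMod p) (Letter n) → Prop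
  | comm (i j : Fin n) : FrobRel p n
      (FreeAlgebra.ι (ZMod p) (Letter.x i) * FreeAlgebra.ι (ZMod p) (Letter.x j))
      (FreeAlgebra.ι (ZMod p) (Letter.x j) * FreeAlgebra.ι (ZMod p) (Letter.x i))
  | frob (i : Fin n) : FrobRel p n
      (FreeAlgebra.ι (ZMod p) (Letter.x i) ^ p * FreeAlgebra.ι (ZMod p) Letter.F)
      (FreeAlgebra.ι (ZMod p) Letter.F * FreeAlgebra.ι (ZMod p) (Letter.x i))

/-- The ring of Frobenius operators over `𝔽_p[x_1, …, x_n]`, that is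
`𝔽_p{x_1, …, x_n, F} / (x_i x_j - x_j x_i, x_i ^ p F - F x_i)`. -/
abbrev FrobRing (p n : ℕ) : Type := RingQuot (FrobRel p n)

/-- The image of a letter in the ring of Frobenius operators. -/
def letter (p n : ℕ) (s : Letter n) : FrobRing p n :=
  RingQuot.mkAlgHom (ZMod p) (FrobRel p n) (FreeAlgebra.ι (ZMod p) s)

/-- The monomials represented by a word with at most `i` letters. -/
def monomialsOfComplexityLE (p n i : ℕ) : Set (FrobRing p n) :=
  {m | ∃ l : List (Letter n), l.length ≤ i ∧ (l.map (letter p n)).prod = m}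

lemma exists_mem_span_monomials (p n : ℕ) (y : FrobRing p n) :
    ∃ i, y ∈ Submodule.span (ZMod p) (monomialsOfComplexityLE p n i) := by
  have mono : ∀ {i j : ℕ}, i ≤ j → Submodule.span (ZMod p) (monomialsOfComplexityLE p n i) ≤
      Submodule.span (ZMod p) (monomialsOfComplexityLE p n j) := fun h =>
    Submodule.span_mono fun _ ⟨l, hl, e⟩ => ⟨l, hl.trans h, e⟩
  obtain ⟨z, rfl⟩ := RingQuot.mkAlgHom_surjective (ZMod p) (FrobRel p n) y
  induction z using FreeAlgebra.induction with
  | grade0 r =>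
    refine ⟨0, ?_⟩
    rw [AlgHom.commutes, Algebra.algebraMap_eq_smul_one]
    exact Submodule.smul_mem _ _ (Submodule.subset_span ⟨[], le_rfl, rfl⟩)
  | grade1 s => exact ⟨1, Submodule.subset_span ⟨[s], le_rfl, by simp [letter]⟩⟩
  | mul a b ha hb =>
    obtain ⟨i, hi⟩ := ha
    obtain ⟨j, hj⟩ := hb
    refine ⟨i + j, ?_⟩
    rw [map_mul]
    have h := Submodule.mul_mem_mul hi hj
    rw [Submodule.span_mul_span] at h
    refine Submodule.span_mono ?_ h
    rintro _ ⟨_, ⟨l, hl, rfl⟩, _, ⟨l', hl', rfl⟩, rfl⟩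
    exact ⟨l ++ l', by simp; omega, by simp⟩
  | add a b ha hb =>
    obtain ⟨i, hi⟩ := ha
    obtain ⟨j, hj⟩ := hb
    refine ⟨i + j, ?_⟩
    rw [map_add]
    exact add_mem (mono (by omega) hi) (mono (by omega) hj)

/-- The Bernstein filtration: `B_i` is the `𝔽_p`-span of the monomials of complexity at most
`i`, the complexity of a monomial being the length of a shortest word representing it. -/
def bernsteinFiltration (p n : ℕ) : RingFiltration (ZMod p) (FrobRing p n) where
  piece i := Submodule.span (ZMod p) (monomialsOfComplexityLE p n i)
  mono h := Submodule.span_mono fun _ ⟨l, hl, e⟩ => ⟨l, hl.trans h, e⟩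
  exhaustive := exists_mem_span_monomials p n
  one_mem := Submodule.subset_span ⟨[], le_rfl, rfl⟩
  mul_mem {i j _ _} hx hy := by
    have h := Submodule.mul_mem_mul hx hy
    rw [Submodule.span_mul_span] at h
    refine Submodule.span_mono ?_ h
    rintro _ ⟨_, ⟨l, hl, rfl⟩, _, ⟨l', hl', rfl⟩, rfl⟩
    exact ⟨l ++ l', by simp; omega, by simp⟩

end FrobFilt

/-! The theorem rests on left coherence of the graded ring `A`. Over such a ring, kernels, cokernels
and extensions of finitely presented modules are finitely presented, and so is a finitely generated
submodule of a finitely presented module.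

Coherence (`isLeftCoherent_gr_bernsteinFiltration`). In `x_i ^ p F = F x_i` the left side has `p + 1
≥ 3` letters and the right side two, so in `A` the relation becomes `x_i ^ p F = 0`. Hence `A = S ⊕
⨁ α, e_α A`, where `S` is the commutative Noetherian subring generated by the classes of the `x_i`
and `e_α` is the class of `x ^ α F` with all exponents below `p`. There are finitely many `e_α`,
each `e_α A` is free, and `S` preserves their additive span. A module with an adapted lattice `L` is
generated by `L`, subject to the `S`-relations of `L` and finitely many identities for `e_α • v`, so
it is finitely presented (`IsAdapted.finitePresentation`). The free module `A ^ r` has such a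
lattice, lattices can be enlarged to contain any finite set, and they pass to quotients and
submodules generated by elements of `L`.

Filtrations (`isFinitelyPresented_subquotients`). For `A ⊆ B` write `U^c` for `shiftedU`, `G^c` for
`grDiag`. Up to shifts there are exact sequences `0 → U^(c+1) → U^c → G^c → 0`, `0 → V^c → V^(c+1) →
G^(c+1) → 0` and `0 → V^c → gr_B → coV^c → 0`, and `G^(c+1)` is both a quotient of `U^(c+1)` and a
submodule of `coV^c`. Induction on `c`, starting from `U^0 ≅ gr_A`, gives finite presentation of all
of them. Then `gr` of `T^a` is an extension of `U^a` by `V^(a-1)`, so `T^a` is great, and the same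
induction applies to each pair `T^a ⊆ T^b`. -/

open scoped Pointwise

namespace FrobFilt

/-! ### A coherence criterion for rings of the form `S ⊕ ⨁ α, e_α A`. -/

/-- A ring `A` with a subring `S` and a finite family `e` such that
`A = S ⊕ ⨁ α, e α * A`, each `e α` generating a free right ideal, where `S` maps the additive
group spanned by the `e α` into itself. -/
structure IsFreeExtension {A ι : Type*} [Ring A] [Fintype ι] (S : Subring A) (e : ι → A) :
    Prop where
  mul_mem_span : ∀ s ∈ S, ∀ α, s * e α ∈ Submodule.span ℤ (Set.range e)
  induction : ∀ H : AddSubgroup A, (∀ s ∈ S, s ∈ H) → (∀ α, ∀ a ∈ H, e α * a ∈ H) → ∀ a, a ∈ H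
  eq_zero : ∀ a : ι → A, ∑ α, e α * a α ∈ S → ∀ α, a α = 0

/-- An `S`-lattice `L` generating `M` such that the only relations between `L` and
`⨁ α, e α * M` come from a finite subset `V` of `L`. -/
structure IsAdapted {A ι M : Type*} [Ring A] [Fintype ι] [AddCommGroup M] [Module A M]
    {S : Subring A} (e : ι → A) (L : Submodule S M) (V : Set M) : Prop where
  fg : L.FG
  span_eq_top : Submodule.span A (L : Set M) = ⊤
  finite : V.Finite
  subset : V ⊆ L
  smul_mem : ∀ v ∈ V, ∀ α, e α • v ∈ L
  mem_of_sum_mem : ∀ m : ι → M, ∑ α, e α • m α ∈ L → ∀ α, m α ∈ V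

section Coherence

variable {A ι M : Type*} [Ring A] [Fintype ι] [AddCommGroup M] [Module A M]
  {S : Subring A} {e : ι → A}

/-- For fixed `x ∈ L`, the ring elements carrying `x` into `H` form an additive group containing `S`
and stable under the `e α`, hence everything. -/
lemma IsFreeExtension.induction_module (h : IsFreeExtension S e) (L : Submodule S M)
    (H : AddSubgroup M) (hL : ∀ m ∈ L, m ∈ H) (he : ∀ α, ∀ m ∈ H, e α • m ∈ H)
    {m : M} (hm : m ∈ Submodule.span A (L : Set M)) : m ∈ H := by
  induction hm using Submodule.closure_induction with
  | zero => exact zero_mem _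
  | add x y _ _ hx hy => exact add_mem hx hy
  | smul_mem r x hx =>
    exact h.induction (H.comap (AddMonoidHom.flip (AddMonoidHom.smul (R := A)) x))
      (fun s hs => hL _ (L.smul_mem ⟨s, hs⟩ hx))
      (fun α a ha => by
        have := he α _ ha
        simpa [mul_smul] using this) r

/-- The additive group `L + ∑ α, e α * (L + ∑ α, e α * (L + ⋯))`. -/
def level (e : ι → A) (L : Submodule S M) : ℕ → AddSubgroup M
  | 0 => L.toAddSubgroup
  | d + 1 =>
    { carrier := {z | ∃ y ∈ L, ∃ m : ι → M, (∀ α, m α ∈ level e L d) ∧ z = y + ∑ α, e α • m α}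
      zero_mem' := ⟨0, zero_mem _, 0, fun _ => zero_mem _, by simp⟩
      add_mem' := by
        rintro _ _ ⟨y, hy, m, hm, rfl⟩ ⟨y', hy', m', hm', rfl⟩
        refine ⟨y + y', add_mem hy hy', m + m', fun α => add_mem (hm α) (hm' α), ?_⟩
        simp only [Pi.add_apply, smul_add, Finset.sum_add_distrib]
        abel
      neg_mem' := by
        rintro _ ⟨y, hy, m, hm, rfl⟩
        refine ⟨-y, neg_mem hy, -m, fun α => neg_mem (hm α), ?_⟩
        simp only [Pi.neg_apply, smul_neg, Finset.sum_neg_distrib]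
        abel }

lemma le_level (L : Submodule S M) (d : ℕ) {m : M} (hm : m ∈ L) : m ∈ level e L d := by
  cases d with
  | zero => exact hm
  | succ d => exact ⟨m, hm, 0, fun _ => zero_mem _, by simp⟩

lemma level_mono (L : Submodule S M) : Monotone (level e L) := by
  refine monotone_nat_of_le_succ fun d => ?_
  induction d with
  | zero => exact fun m hm => le_level L 1 hm
  | succ d ih =>
    rintro _ ⟨y, hy, m, hm, rfl⟩
    exact ⟨y, hy, m, fun α => ih (hm α), rfl⟩

lemma IsFreeExtension.exists_mem_level (h : IsFreeExtension S e) (L : Submodule S M)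
    (hL : Submodule.span A (L : Set M) = ⊤) (m : M) : ∃ d, m ∈ level e L d := by
  classical
  let H : AddSubgroup M :=
    { carrier := {m | ∃ d, m ∈ level e L d}
      zero_mem' := ⟨0, zero_mem _⟩
      add_mem' := by
        rintro a b ⟨d, hd⟩ ⟨d', hd'⟩
        exact ⟨max d d', add_mem (level_mono L (le_max_left _ _) hd)
          (level_mono L (le_max_right _ _) hd')⟩
      neg_mem' := by
        rintro a ⟨d, hd⟩
        exact ⟨d, neg_mem hd⟩ }
  have hm : m ∈ Submodule.span A (L : Set M) := hL ▸ Submodule.mem_top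
  refine h.induction_module L H (fun m hm => ⟨0, hm⟩) ?_ hm
  rintro α m ⟨d, hd⟩
  refine ⟨d + 1, 0, zero_mem _, Pi.single α m, fun β => ?_, ?_⟩
  · by_cases hβ : β = α
    · subst hβ; simpa using hd
    · simp [hβ]
  · rw [Finset.sum_eq_single α] <;> simp +contextual

lemma IsFreeExtension.mem_add_sum (h : IsFreeExtension S e) (L : Submodule S M)
    {m : M} (hm : m ∈ Submodule.span A (L : Set M)) :
    ∃ y ∈ L, ∃ u : ι → M, (∀ α, u α ∈ Submodule.span A (L : Set M)) ∧
      m = y + ∑ α, e α • u α := by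
  classical
  let H : AddSubgroup M :=
    { carrier := {m | ∃ y ∈ L, ∃ u : ι → M, (∀ α, u α ∈ Submodule.span A (L : Set M)) ∧
        m = y + ∑ α, e α • u α}
      zero_mem' := ⟨0, zero_mem _, 0, fun _ => zero_mem _, by simp⟩
      add_mem' := by
        rintro _ _ ⟨y, hy, m, hm, rfl⟩ ⟨y', hy', m', hm', rfl⟩
        refine ⟨y + y', add_mem hy hy', m + m', fun α => add_mem (hm α) (hm' α), ?_⟩
        simp only [Pi.add_apply, smul_add, Finset.sum_add_distrib]
        abel
      neg_mem' := by
        rintro _ ⟨y, hy, m, hm, rfl⟩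
        refine ⟨-y, neg_mem hy, -m, fun α => neg_mem (hm α), ?_⟩
        simp only [Pi.neg_apply, smul_neg, Finset.sum_neg_distrib]
        abel }
  refine h.induction_module L H (fun m hm => ⟨m, hm, 0, fun _ => zero_mem _, by simp⟩) ?_ hm
  rintro α _ ⟨y, hy, u, hu, rfl⟩
  refine ⟨0, zero_mem _, Pi.single α (y + ∑ α, e α • u α), fun β => ?_, ?_⟩
  · by_cases hβ : β = α
    · subst hβ
      simpa using add_mem (Submodule.subset_span hy)
        (Submodule.sum_mem _ fun γ _ => Submodule.smul_mem _ _ (hu γ))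
    · simp [hβ]
  · generalize y + ∑ α, e α • u α = q
    rw [zero_add, Finset.sum_eq_single α] <;> simp +contextual

/-- The coefficients are integers because `S` preserves the additive span of the `e α`. This is what
keeps the set `V` finite in `IsAdapted.enlarge`. -/
lemma IsFreeExtension.exists_of_mem_span (h : IsFreeExtension S e) {m x : M}
    (hx : x ∈ Submodule.span S (Set.range fun α => e α • m)) :
    ∃ c : ι → ℤ, x = ∑ α, e α • (c α • m) := by
  classical
  induction hx using Submodule.closure_induction with
  | zero => exact ⟨0, by simp⟩
  | add x y _ _ hx hy =>
    obtain ⟨c, rfl⟩ := hx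
    obtain ⟨d, rfl⟩ := hy
    exact ⟨c + d, by simp [add_smul, Finset.sum_add_distrib]⟩
  | smul_mem s x hx =>
    obtain ⟨α, rfl⟩ := hx
    obtain ⟨c, hc⟩ := (Submodule.mem_span_range_iff_exists_fun ℤ).mp (h.mul_mem_span s s.2 α)
    refine ⟨c, ?_⟩
    change (s : A) • e α • m = _
    rw [← mul_smul, ← hc, Finset.sum_smul]
    exact Finset.sum_congr rfl fun β _ => by rw [smul_comm (e β), smul_assoc]

/-- Adjoining all `e α • m` to `L` creates only relations that involve multiples of `m`: if `∑ α, e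
α • u α` lies in the new lattice, subtracting suitable `e α • (c α • m)` returns it to `L`, so `u α
∈ V + ℤ m`. This set is finite because `p` kills `m`, and it lies in the lattice because `m ∈ L`. -/
lemma IsAdapted.enlarge (h : IsFreeExtension S e) {L : Submodule S M} {V : Set M}
    (hL : IsAdapted e L V) {p : ℕ} (hp : p ≠ 0) (hpM : ∀ m : M, p • m = 0) {m : M} (hm : m ∈ L) :
    ∃ (L' : Submodule S M) (V' : Set M), IsAdapted e L' V' ∧ L ≤ L' ∧ ∀ α, e α • m ∈ L' := by
  have hmem : ∀ α, e α • m ∈ L ⊔ Submodule.span S (Set.range fun α => e α • m) := fun α =>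
    Submodule.mem_sup_right (Submodule.subset_span ⟨α, rfl⟩)
  have hzm : ∀ c : ℤ, c • m ∈ L := fun c => zsmul_mem hm c
  refine ⟨L ⊔ Submodule.span S (Set.range fun α => e α • m),
    V + (AddSubgroup.zmultiples m : Set M), ?_, le_sup_left, hmem⟩
  refine ⟨hL.fg.sup (Submodule.fg_span (Set.finite_range _)), ?_, ?_, ?_, ?_, ?_⟩
  · exact top_le_iff.mp (hL.span_eq_top ▸ Submodule.span_mono (le_sup_left (a := L)))
  · refine hL.finite.add ?_
    exact Set.finite_coe_iff.mp (finite_zmultiples.mpr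
      (isOfFinAddOrder_iff_nsmul_eq_zero.mpr ⟨p, Nat.pos_of_ne_zero hp, hpM m⟩))
  · rintro _ ⟨v, hv, _, ⟨c, rfl⟩, rfl⟩
    exact le_sup_left (a := L) (add_mem (hL.subset hv) (hzm c))
  · rintro _ ⟨v, hv, _, ⟨c, rfl⟩, rfl⟩ α
    simp only [smul_add]
    refine add_mem (Submodule.mem_sup_left (hL.smul_mem v hv α)) ?_
    rw [smul_comm]
    exact zsmul_mem (hmem α) c
  · intro u hu α
    obtain ⟨y, hy, x, hx, hyx⟩ := Submodule.mem_sup.mp hu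
    obtain ⟨c, rfl⟩ := h.exists_of_mem_span hx
    have h1 : ∑ α, e α • (u α - c α • m) ∈ L := by
      simp only [smul_sub, Finset.sum_sub_distrib, ← hyx]
      simpa using hy
    exact ⟨_, hL.mem_of_sum_mem _ h1 α, _, ⟨c α, rfl⟩, by simp⟩

lemma IsAdapted.exists_mem (h : IsFreeExtension S e) {L : Submodule S M} {V : Set M}
    (hL : IsAdapted e L V) {p : ℕ} (hp : p ≠ 0) (hpM : ∀ m : M, p • m = 0) (m : M) :
    ∃ (L' : Submodule S M) (V' : Set M), IsAdapted e L' V' ∧ L ≤ L' ∧ m ∈ L' := by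
  let H : AddSubgroup M :=
    -- Quantifying over all larger adapted lattices makes the condition additive: the summands can
    -- be absorbed one after the other.
    { carrier := {m | ∀ (L₁ : Submodule S M) (V₁ : Set M), IsAdapted e L₁ V₁ → L ≤ L₁ →
        ∃ (L' : Submodule S M) (V' : Set M), IsAdapted e L' V' ∧ L₁ ≤ L' ∧ m ∈ L'}
      zero_mem' := fun L₁ V₁ h₁ _ => ⟨L₁, V₁, h₁, le_rfl, zero_mem _⟩
      add_mem' := by
        intro a b ha hb L₁ V₁ h₁ hL₁
        obtain ⟨L₂, V₂, h₂, hL₂, ha₂⟩ := ha L₁ V₁ h₁ hL₁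
        obtain ⟨L₃, V₃, h₃, hL₃, hb₃⟩ := hb L₂ V₂ h₂ (hL₁.trans hL₂)
        exact ⟨L₃, V₃, h₃, hL₂.trans hL₃, add_mem (hL₃ ha₂) hb₃⟩
      neg_mem' := by
        intro a ha L₁ V₁ h₁ hL₁
        obtain ⟨L₂, V₂, h₂, hL₂, ha₂⟩ := ha L₁ V₁ h₁ hL₁
        exact ⟨L₂, V₂, h₂, hL₂, neg_mem ha₂⟩ }
  have hm : m ∈ Submodule.span A (L : Set M) := hL.span_eq_top ▸ Submodule.mem_top
  refine h.induction_module L H (fun m hm L₁ V₁ h₁ hL₁ => ⟨L₁, V₁, h₁, le_rfl, hL₁ hm⟩) ?_ hm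
    L V hL le_rfl
  intro α a ha L₁ V₁ h₁ hL₁
  obtain ⟨L₂, V₂, h₂, hL₂, ha₂⟩ := ha L₁ V₁ h₁ hL₁
  obtain ⟨L₃, V₃, h₃, hL₃, ha₃⟩ := h₂.enlarge h hp hpM ha₂
  exact ⟨L₃, V₃, h₃, hL₂.trans hL₃, ha₃ α⟩

lemma IsAdapted.exists_subset (h : IsFreeExtension S e) {L : Submodule S M} {V : Set M}
    (hL : IsAdapted e L V) {p : ℕ} (hp : p ≠ 0) (hpM : ∀ m : M, p • m = 0) (t : Finset M) :
    ∃ (L' : Submodule S M) (V' : Set M), IsAdapted e L' V' ∧ (t : Set M) ⊆ L' := by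
  classical
  induction t using Finset.induction_on with
  | empty => exact ⟨L, V, hL, by simp⟩
  | insert a t _ ih =>
    obtain ⟨L₁, V₁, h₁, ht⟩ := ih
    obtain ⟨L₂, V₂, h₂, hL₂, ha⟩ := h₁.exists_mem h hp hpM a
    refine ⟨L₂, V₂, h₂, ?_⟩
    rw [Finset.coe_insert, Set.insert_subset_iff]
    exact ⟨ha, ht.trans hL₂⟩

/-- The elements of `A ^ r` with coordinates in `S`. -/
def standardLattice (S : Subring A) (r : ℕ) : Submodule S (Fin r → A) where
  carrier := {z | ∀ i, z i ∈ S}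
  zero_mem' _ := zero_mem S
  add_mem' hx hy i := add_mem (hx i) (hy i)
  smul_mem' s _ hx i := mul_mem s.2 (hx i)

lemma standardLattice_eq_span (S : Subring A) (r : ℕ) : standardLattice S r =
    Submodule.span S (Set.range fun i : Fin r => (Pi.single i 1 : Fin r → A)) := by
  refine le_antisymm (fun z hz => ?_) (Submodule.span_le.mpr ?_)
  · have : z = ∑ i, (⟨z i, hz i⟩ : S) • (Pi.single i 1 : Fin r → A) := by
      ext j
      simp [Finset.sum_apply, Pi.single_apply, Subring.smul_def]
    rw [this]
    exact Submodule.sum_mem _ fun i _ => Submodule.smul_mem _ _ (Submodule.subset_span ⟨i, rfl⟩)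
  · rintro _ ⟨i, rfl⟩ j
    rcases eq_or_ne j i with rfl | hj
    · simp
    · simp [hj]

lemma fg_standardLattice (S : Subring A) (r : ℕ) : (standardLattice S r).FG := by
  rw [standardLattice_eq_span]
  exact Submodule.fg_span (Set.finite_range _)

lemma IsFreeExtension.isAdapted_standardLattice (h : IsFreeExtension S e) (r : ℕ) :
    IsAdapted e (standardLattice S r) {0} where
  fg := fg_standardLattice S r
  span_eq_top := by
    refine top_le_iff.mp fun z _ => ?_
    have : z = ∑ i, z i • (Pi.single i 1 : Fin r → A) := by
      ext j
      simp [Finset.sum_apply, Pi.single_apply]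
    rw [this]
    refine Submodule.sum_mem _ fun i _ => Submodule.smul_mem _ _ (Submodule.subset_span ?_)
    rw [standardLattice_eq_span]
    exact Submodule.subset_span ⟨i, rfl⟩
  finite := Set.finite_singleton 0
  subset := by simp
  smul_mem := by simp
  mem_of_sum_mem m hm α := by
    refine Set.mem_singleton_iff.mpr (funext fun i => ?_)
    refine h.eq_zero (fun α => m α i) ?_ α
    simpa [Finset.sum_apply] using hm i

/-- Since `t ⊆ L`, the submodule divided out is `span S t + ∑ α, e α • span A t`. The first part
stays in `L`, and the second only changes each `m α` by an element that dies in the quotient. -/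
lemma IsAdapted.quotient (h : IsFreeExtension S e) {L : Submodule S M} {V : Set M}
    (hL : IsAdapted e L V) (t : Set M) (ht : t ⊆ L) :
    IsAdapted e (L.map ((Submodule.span A t).mkQ.restrictScalars S))
      ((Submodule.span A t).mkQ '' V) where
  fg := hL.fg.map _
  span_eq_top := by
    rw [Submodule.map_coe]
    change Submodule.span A ((Submodule.span A t).mkQ '' (L : Set M)) = ⊤
    rw [← Submodule.map_span, hL.span_eq_top, Submodule.map_top, Submodule.range_mkQ]
  finite := hL.finite.image _
  subset := Set.image_mono hL.subset
  smul_mem := by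
    rintro _ ⟨v, hv, rfl⟩ α
    exact ⟨e α • v, hL.smul_mem v hv α, map_smul (Submodule.span A t).mkQ _ _⟩
  mem_of_sum_mem m hm α := by
    choose u hu using fun α => (Submodule.span A t).mkQ_surjective (m α)
    obtain ⟨y, hy, hy'⟩ := hm
    have h1 : (∑ α, e α • u α) - y ∈ Submodule.span A t := by
      rw [← (Submodule.span A t).ker_mkQ, LinearMap.mem_ker, map_sub, sub_eq_zero]
      refine Eq.trans ?_ hy'.symm
      simp [hu]
    have hle : (Submodule.span S t : Set M) ⊆ Submodule.span A t :=
      Submodule.span_le_restrictScalars S A t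
    have heq : Submodule.span A (Submodule.span S t : Set M) = Submodule.span A t :=
      Submodule.span_span_of_tower S A t
    obtain ⟨y', hy', n, hn, hsum⟩ := h.mem_add_sum (Submodule.span S t) (heq ▸ h1)
    have h2 : ∑ α, e α • (u α - n α) ∈ L := by
      have : ∑ α, e α • (u α - n α) = y + y' := by
        simp only [smul_sub, Finset.sum_sub_distrib]
        rw [sub_eq_iff_eq_add, add_assoc, ← hsum]
        abel
      rw [this]
      exact add_mem hy (Submodule.span_le.mpr ht hy')
    -- The corrected lift `u α - n α` lies in `V` and has the same image `m α`.
    refine ⟨_, hL.mem_of_sum_mem _ h2 α, ?_⟩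
    have : (Submodule.span A t).mkQ (n α) = 0 := by
      rw [← LinearMap.mem_ker, Submodule.ker_mkQ, ← heq]
      exact hn α
    rw [map_sub, this, sub_zero, hu]

/-- The lattice is the intersection of `L` with the submodule. It is finitely generated because `S`
is Noetherian, and it generates because it contains `t`. -/
lemma IsAdapted.submodule [IsNoetherianRing S] {L : Submodule S M} {V : Set M}
    (hL : IsAdapted e L V) (t : Set M) (ht : t ⊆ L) :
    IsAdapted e (L.comap ((Submodule.span A t).subtype.restrictScalars S))
      ((Submodule.span A t).subtype ⁻¹' V) where
  fg := by
    have : IsNoetherian S L := isNoetherian_of_fg_of_noetherian L hL.fg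
    let f : L.comap ((Submodule.span A t).subtype.restrictScalars S) →ₗ[S] L :=
      ((Submodule.span A t).subtype.restrictScalars S).restrict fun x hx => hx
    have hf : Function.Injective f := fun x y hxy => by
      have := congrArg Subtype.val hxy
      exact Subtype.ext (Subtype.ext this)
    have := isNoetherian_of_injective f hf
    exact Module.Finite.iff_fg.mp inferInstance
  span_eq_top := by
    refine top_le_iff.mp ?_
    rw [← Submodule.span_span_coe_preimage (R := A) (s := t)]
    exact Submodule.span_mono fun x hx => ht hx
  finite := hL.finite.preimage (Submodule.subtype_injective _).injOn
  subset x hx := hL.subset hx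
  smul_mem v hv α := hL.smul_mem v hv α
  mem_of_sum_mem m hm α := by
    refine hL.mem_of_sum_mem (fun α => (m α : M)) ?_ α
    have : (Submodule.span A t).subtype (∑ α, e α • m α) ∈ L := hm
    simpa using this

/-- Generators of `L` give `l : A ^ r → M`. The kernel needs only two finite sets of relations:
those among elements of `S ^ r`, finitely generated by Noetherianity, and those expressing `e α • v
∈ L` for `v ∈ V`. -/
lemma IsAdapted.finitePresentation [IsNoetherianRing S] (h : IsFreeExtension S e)
    {L : Submodule S M} {V : Set M} (hL : IsAdapted e L V) : Module.FinitePresentation A M := by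
  obtain ⟨r, g, hg⟩ := Submodule.fg_iff_exists_fin_generating_family.mp hL.fg
  let l : (Fin r → A) →ₗ[A] M := Fintype.linearCombination A g
  set P := standardLattice S r with hP
  have hPL : P.map (l.restrictScalars S) = L := by
    rw [hP, standardLattice_eq_span, Submodule.map_span, ← hg, ← Set.range_comp]
    congr 2
    ext i
    simp [l, Fintype.linearCombination_apply_single]
  have hsurj : Function.Surjective l := by
    rw [← LinearMap.range_eq_top, ← top_le_iff, ← hL.span_eq_top, Submodule.span_le, ← hPL]
    rintro _ ⟨z, -, rfl⟩
    exact ⟨z, rfl⟩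
  have hlift : ∀ m ∈ L, ∃ z ∈ P, l z = m := fun m hm => by
    rw [← hPL] at hm
    exact hm
  choose! lift hliftP hlift using hlift
  have : IsNoetherian S P := isNoetherian_of_fg_of_noetherian P (fg_standardLattice S r)
  obtain ⟨t, ht⟩ : (P ⊓ LinearMap.ker (l.restrictScalars S)).FG :=
    isNoetherian_submodule.mp this _ inf_le_left
  let T : Set (Fin r → A) := (fun q : M × ι => e q.2 • lift q.1 - lift (e q.2 • q.1)) ''
    (V ×ˢ Set.univ)
  have hTfin : T.Finite := (hL.finite.prod Set.finite_univ).image _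
  have hPker : ∀ z ∈ P, l z = 0 → z ∈ Submodule.span A (t ∪ T) := fun z hz hlz => by
    have hz' : z ∈ Submodule.span S (t : Set (Fin r → A)) := ht ▸ ⟨hz, hlz⟩
    exact Submodule.span_mono Set.subset_union_left (Submodule.span_le_restrictScalars S A _ hz')
  have hker : LinearMap.ker l = Submodule.span A (t ∪ T) := by
    refine le_antisymm ?_ ?_
    -- Induction on the nesting depth of `e α` in `z`. If `l (y + ∑ α, e α • m α) = 0`, then `∑ α, e
    -- α • l (m α) ∈ L`, so every `l (m α)` lies in `V`. Modulo the relations `m α` may be replaced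
    -- by `lift (l (m α))`, which brings the element down to depth zero.
    · suffices hd : ∀ d, ∀ z ∈ level e P d, l z = 0 → z ∈ Submodule.span A (t ∪ T) by
        intro z hz
        obtain ⟨d, hzd⟩ := h.exists_mem_level P (h.isAdapted_standardLattice r).span_eq_top z
        exact hd d z hzd hz
      intro d
      induction d with
      | zero => exact hPker
      | succ d ih =>
        rintro _ ⟨y, hy, m, hm, rfl⟩ hz
        rw [map_add, map_sum] at hz
        simp only [map_smul] at hz
        have hly : l y ∈ L := hPL ▸ ⟨y, hy, rfl⟩
        have hV : ∀ α, l (m α) ∈ V := hL.mem_of_sum_mem _ (by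
          rw [eq_neg_of_add_eq_zero_right hz]
          exact neg_mem hly)
        have h1 : ∀ α, m α - lift (l (m α)) ∈ Submodule.span A (t ∪ T) := fun α => by
          refine ih _ (sub_mem (hm α) (le_level P d (hliftP _ (hL.subset (hV α))))) ?_
          rw [map_sub, hlift _ (hL.subset (hV α)), sub_self]
        have h2 : ∀ α, e α • lift (l (m α)) - lift (e α • l (m α)) ∈
            Submodule.span A (t ∪ T) := fun α =>
          Submodule.subset_span (Or.inr ⟨(l (m α), α), ⟨hV α, trivial⟩, rfl⟩)
        have h3 : y + ∑ α, lift (e α • l (m α)) ∈ Submodule.span A (t ∪ T) := by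
          refine hPker _ (add_mem hy (Submodule.sum_mem _ fun α _ =>
            hliftP _ (hL.smul_mem _ (hV α) α))) ?_
          rw [map_add, map_sum, ← hz]
          exact congrArg _ (Finset.sum_congr rfl fun α _ => hlift _ (hL.smul_mem _ (hV α) α))
        have h4 : y + ∑ α, e α • m α = (y + ∑ α, lift (e α • l (m α))) +
            ∑ α, (e α • (m α - lift (l (m α))) +
              (e α • lift (l (m α)) - lift (e α • l (m α)))) := by
          rw [add_assoc, ← Finset.sum_add_distrib]
          congr 1
          refine Finset.sum_congr rfl fun α _ => ?_
          rw [smul_sub]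
          abel
        rw [h4]
        exact add_mem h3 (Submodule.sum_mem _ fun α _ =>
          add_mem (Submodule.smul_mem _ _ (h1 α)) (h2 α))
    · rw [Submodule.span_le]
      rintro z (hz | ⟨⟨v, α⟩, ⟨hv, -⟩, rfl⟩)
      · have : z ∈ P ⊓ LinearMap.ker (l.restrictScalars S) := ht ▸ Submodule.subset_span hz
        exact this.2
      · change l _ = 0
        rw [map_sub, map_smul, hlift _ (hL.subset hv), hlift _ (hL.smul_mem _ hv α), sub_self]
  refine Module.finitePresentation_of_surjective l hsurj ?_
  rw [hker]
  exact Submodule.fg_span (t.finite_toSet.union hTfin)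

/-- A ring is left coherent if finitely generated submodules of finitely presented left modules
are finitely presented. -/
def IsLeftCoherent (A : Type*) [Ring A] : Prop :=
  ∀ (r : ℕ) (K : Submodule A (Fin r → A)), K.FG → ∀ N : Submodule A ((Fin r → A) ⧸ K), N.FG →
    Module.FinitePresentation A N

/-- An adapted lattice of `A ^ r` is enlarged to contain the generators `t` of the relations, pushed
to the quotient, enlarged to contain the generators `t'` of the submodule, and intersected with it.
-/
theorem IsFreeExtension.isLeftCoherent [IsNoetherianRing S] (h : IsFreeExtension S e) {p : ℕ}
    (hp : p ≠ 0) (hpA : (p : A) = 0) : IsLeftCoherent A := by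
  rintro r _ ⟨t, rfl⟩ _ ⟨t', rfl⟩
  have hpM : ∀ {M : Type _} [AddCommGroup M] [Module A M] (m : M), p • m = 0 := fun m => by
    rw [← Nat.cast_smul_eq_nsmul A, hpA, zero_smul]
  obtain ⟨L, V, hL, ht⟩ := (h.isAdapted_standardLattice r).exists_subset h hp hpM t
  obtain ⟨L', V', hL', ht'⟩ := (hL.quotient h t ht).exists_subset h hp hpM t'
  exact (hL'.submodule t' ht').finitePresentation h

lemma IsLeftCoherent.finitePresentation_of_injective (hA : IsLeftCoherent A)
    {N : Type*} [AddCommGroup N] [Module A N] [Module.FinitePresentation A M] [Module.Finite A N]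
    (f : N →ₗ[A] M) (hf : Function.Injective f) : Module.FinitePresentation A N := by
  obtain ⟨r, K, E, hK⟩ := Module.FinitePresentation.exists_fin A M
  let g : N →ₗ[A] ((Fin r → A) ⧸ K) := E.toLinearMap ∘ₗ f
  have hg : Function.Injective g := E.injective.comp hf
  have := hA r K hK (LinearMap.range g) (Submodule.fg_range g)
  exact Module.FinitePresentation.of_equiv (LinearEquiv.ofInjective g hg).symm

end Coherence

/-! ### Graded maps between direct sums of subquotients, and exact sequences. -/

section GradedMaps

variable {K R M N : Type*} [CommRing K] [Ring R] [Algebra K R]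
  [AddCommGroup M] [Module K M] [Module R M] [AddCommGroup N] [Module K N] [Module R N]
  {W : RingFiltration K R}

namespace Subquotients

/-- The class of `m` in the `i`-th summand of `⨁ i, high_i / low_i`. -/
def tot (P : Subquotients W M) (i : ℕ) (m : M) (hm : m ∈ P.high i) : P.Total :=
  DirectSum.of P.Comp i (P.cls i m hm)

lemma tot_congr (P : Subquotients W M) {i j : ℕ} {m m' : M} {hm : m ∈ P.high i}
    {hm' : m' ∈ P.high j} (hij : i = j) (h : m = m') : P.tot i m hm = P.tot j m' hm' := by
  subst hij h
  rfl

lemma tot_add (P : Subquotients W M) {i : ℕ} {m m' : M} (hm : m ∈ P.high i)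
    (hm' : m' ∈ P.high i) : P.tot i (m + m') (add_mem hm hm') = P.tot i m hm + P.tot i m' hm' :=
  map_add (DirectSum.of P.Comp i) (P.cls i m hm) (P.cls i m' hm')

lemma tot_eq_zero (P : Subquotients W M) {i : ℕ} {m : M} (hm : m ∈ P.low i) :
    P.tot i m (P.low_le_high i hm) = 0 := by
  have : P.cls i m (P.low_le_high i hm) = P.cls i 0 (zero_mem _) :=
    P.cls_eq_cls.mpr (by simpa using hm)
  unfold tot
  rw [this]
  exact map_zero (DirectSum.of P.Comp i)

lemma total_induction (P : Subquotients W M) (H : AddSubgroup P.Total)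
    (h : ∀ i m hm, P.tot i m hm ∈ H) (z : P.Total) : z ∈ H := by
  refine DirectSum.induction_on (motive := fun z : P.Total => z ∈ H) z (zero_mem H) ?_
    (fun x y hx hy => add_mem hx hy)
  intro i x
  obtain ⟨m, hm, rfl⟩ := P.exists_cls x
  exact h i m hm

/-- The class of `x` in the `i`-th summand of the associated graded ring. -/
def _root_.FrobFilt.RingFiltration.symbol (W : RingFiltration K R) (i : ℕ) (x : R)
    (hx : x ∈ W.piece i) : W.Gr :=
  W.self.tot i x hx

lemma _root_.FrobFilt.RingFiltration.gr_induction (W : RingFiltration K R) (H : AddSubgroup W.Gr)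
    (h : ∀ i x hx, W.symbol i x hx ∈ H) (a : W.Gr) : a ∈ H :=
  W.self.total_induction H h a

lemma symbol_smul_tot (P : Subquotients W M) {k i : ℕ} {x : R} {m : M} (hx : x ∈ W.piece k)
    (hm : m ∈ P.high i) : W.symbol k x hx • P.tot i m hm =
      P.tot (k + i) (x • m) (P.smul_high hx hm) :=
  DirectSum.Gmodule.of_smul_of W.self.Comp P.Comp (W.self.cls k x hx) (P.cls i m hm)

/-- The projection of `⨁ i, high_i / low_i` to its `i`-th summand. -/
def proj (P : Subquotients W M) (i : ℕ) : P.Total →+ P.Comp i :=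
  DFinsupp.evalAddMonoidHom (β := P.Comp) i

lemma proj_tot_same (P : Subquotients W M) {i : ℕ} {m : M} (hm : m ∈ P.high i) :
    P.proj i (P.tot i m hm) = P.cls i m hm :=
  DirectSum.of_eq_same (β := P.Comp) i (P.cls i m hm)

lemma proj_tot_of_ne (P : Subquotients W M) {i j : ℕ} {m : M} (hm : m ∈ P.high i) (hij : i ≠ j) :
    P.proj j (P.tot i m hm) = 0 :=
  DirectSum.of_eq_of_ne (β := P.Comp) i j (P.cls i m hm) hij.symm

lemma exists_eq_sum (P : Subquotients W M) (z : P.Total) :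
    ∃ (s : Finset ℕ) (f : ℕ → M) (hf : ∀ i, f i ∈ P.high i),
      (∀ i, P.proj i z = P.cls i (f i) (hf i)) ∧ z = ∑ i ∈ s, P.tot i (f i) (hf i) := by
  classical
  choose f hf hfz using fun i => P.exists_cls (P.proj i z)
  refine ⟨DFinsupp.support (β := P.Comp) z, f, hf, hfz, ?_⟩
  refine (DirectSum.sum_support_of (β := P.Comp) z).symm.trans ?_
  refine Finset.sum_congr rfl fun i _ => ?_
  exact congrArg (DirectSum.of P.Comp i) (hfz i)

/-- The additive map `⨁ i, high_i / low_i → ⨁ i, high'_i / low'_i` induced by a linear map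
sending `high_i` to `high'_{τ i}` and `low_i` to `low'_{τ i}`. -/
def gradedMap (P : Subquotients W M) (Q : Subquotients W N) (g : M →ₗ[K] N) (τ : ℕ → ℕ)
    (hh : ∀ i, ∀ m ∈ P.high i, g m ∈ Q.high (τ i)) (hl : ∀ i, ∀ m ∈ P.low i, g m ∈ Q.low (τ i)) :
    P.Total →+ Q.Total :=
  DirectSum.toAddMonoid fun i => (DirectSum.of Q.Comp (τ i)).comp
    (Submodule.mapQ ((P.low i).submoduleOf (P.high i)) ((Q.low (τ i)).submoduleOf (Q.high (τ i)))
      (g.restrict (hh i)) fun m hm => hl i m hm).toAddMonoidHom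

lemma gradedMap_tot (P : Subquotients W M) (Q : Subquotients W N) (g : M →ₗ[K] N) (τ : ℕ → ℕ)
    (hh : ∀ i, ∀ m ∈ P.high i, g m ∈ Q.high (τ i)) (hl : ∀ i, ∀ m ∈ P.low i, g m ∈ Q.low (τ i))
    (i : ℕ) (m : M) (hm : m ∈ P.high i) :
    gradedMap P Q g τ hh hl (P.tot i m hm) = Q.tot (τ i) (g m) (hh i m hm) :=
  DirectSum.toAddMonoid_of (β := P.Comp) _ i (P.cls i m hm)

lemma _root_.FrobFilt.RingFiltration.symbol_mul_symbol (W : RingFiltration K R)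
    {k i : ℕ} {x y : R}
    (hx : x ∈ W.piece k) (hy : y ∈ W.piece i) :
    W.symbol k x hx * W.symbol i y hy = W.symbol (k + i) (x * y) (W.mul_mem hx hy) :=
  DirectSum.of_mul_of (W.self.cls k x hx) (W.self.cls i y hy)

/-- The condition for the identity of `M` to induce a map of degree `d` between direct sums of
subquotients. -/
structure Maps (P Q : Subquotients W M) (d : ℕ) : Prop where
  high : ∀ i, P.high i ≤ Q.high (i + d)
  low : ∀ i, P.low i ≤ Q.low (i + d)

variable {P Q T : Subquotients W M} {d : ℕ}

/-- The linear map of degree `d` induced by the identity of `M`. -/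
def Maps.map (h : Maps P Q d) : P.Total →ₗ[W.Gr] Q.Total where
  __ := gradedMap P Q LinearMap.id (· + d) (fun i _ hm => h.high i hm) (fun i _ hm => h.low i hm)
  map_smul' a z := by
    set f := gradedMap P Q LinearMap.id (· + d) (fun i _ hm => h.high i hm)
      (fun i _ hm => h.low i hm) with hf
    change f (a • z) = a • f z
    let H : AddSubgroup W.Gr :=
      { carrier := {a | ∀ z, f (a • z) = a • f z}
        zero_mem' := fun z => by rw [zero_smul, zero_smul, map_zero]
        add_mem' := fun {a b} ha hb z => by rw [add_smul, add_smul, map_add, ha z, hb z]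
        neg_mem' := fun {a} ha z => by rw [neg_smul, neg_smul, map_neg, ha z] }
    refine W.gr_induction H (fun k x hx z => ?_) a z
    let H' : AddSubgroup P.Total :=
      { carrier := {z | f (W.symbol k x hx • z) = W.symbol k x hx • f z}
        zero_mem' := by
          change f (_ • 0) = _ • f 0
          rw [smul_zero, map_zero, smul_zero]
        add_mem' := fun {a b} ha hb => by
          change f (_ • (a + b)) = _ • f (a + b)
          rw [smul_add, map_add, map_add, smul_add, ha, hb]
        neg_mem' := fun {a} ha => by
          change f (_ • -a) = _ • f (-a)
          rw [smul_neg, map_neg, map_neg, smul_neg, ha] }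
    refine P.total_induction H' (fun i m hm => ?_) z
    change f (_ • _) = _ • f _
    rw [symbol_smul_tot, hf, gradedMap_tot, gradedMap_tot, symbol_smul_tot]
    exact tot_congr _ (add_assoc k i d) rfl

lemma Maps.map_tot (h : Maps P Q d) {i : ℕ} {m : M} (hm : m ∈ P.high i) :
    h.map (P.tot i m hm) = Q.tot (i + d) m (h.high i hm) :=
  gradedMap_tot P Q LinearMap.id (· + d) (fun i _ hm => h.high i hm)
    (fun i _ hm => h.low i hm) i m hm

lemma Maps.surjective (h : Maps P Q d) (hs : ∀ i, Q.high (i + d) ≤ P.high i ⊔ Q.low (i + d))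
    (hs' : ∀ i < d, Q.high i ≤ Q.low i) : Function.Surjective h.map := by
  rw [← LinearMap.range_eq_top, ← top_le_iff]
  refine fun z _ => Q.total_induction (LinearMap.range h.map).toAddSubgroup (fun i m hm => ?_) z
  rcases lt_or_ge i d with hi | hi
  · rw [Q.tot_eq_zero (hs' i hi hm)]
    exact zero_mem _
  · obtain ⟨i, rfl⟩ := Nat.exists_eq_add_of_le' hi
    obtain ⟨y, hy, y', hy', rfl⟩ := Submodule.mem_sup.mp (hs i hm)
    refine ⟨P.tot i y hy, ?_⟩
    rw [h.map_tot, Q.tot_add (h.high i hy) (Q.low_le_high _ hy'), Q.tot_eq_zero hy', add_zero]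

lemma Maps.proj_map (h : Maps P Q d) (z : P.Total) (i : ℕ) :
    Q.proj (i + d) (h.map z) =
      Submodule.mapQ ((P.low i).submoduleOf (P.high i))
        ((Q.low (i + d)).submoduleOf (Q.high (i + d)))
        (Submodule.inclusion (h.high i)) (fun _ hm => h.low i hm) (P.proj i z) := by
  set g := Submodule.mapQ ((P.low i).submoduleOf (P.high i))
        ((Q.low (i + d)).submoduleOf (Q.high (i + d)))
        (Submodule.inclusion (h.high i)) (fun _ hm => h.low i hm)
  refine P.total_induction
    (AddMonoidHom.eqLocus ((Q.proj (i + d)).comp h.map.toAddMonoidHom)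
      (g.toAddMonoidHom.comp (P.proj i))) (fun j m hm => ?_) z
  change Q.proj (i + d) (h.map (P.tot j m hm)) = g (P.proj i (P.tot j m hm))
  rw [h.map_tot]
  rcases eq_or_ne j i with rfl | hij
  · rw [proj_tot_same, proj_tot_same]
    rfl
  · rw [proj_tot_of_ne _ _ hij, proj_tot_of_ne _ _ (by omega), map_zero]

/-- The kernel is graded, because `Q.proj (i + d)` of the image depends only on the `i`-th
component. -/
lemma Maps.exists_of_mem_ker (h : Maps P Q d) {z : P.Total} (hz : h.map z = 0) :
    ∃ (s : Finset ℕ) (f : ℕ → M) (hf : ∀ i, f i ∈ P.high i), (∀ i, f i ∈ Q.low (i + d)) ∧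
      z = ∑ i ∈ s, P.tot i (f i) (hf i) := by
  obtain ⟨s, f, hf, hfz, hz'⟩ := P.exists_eq_sum z
  refine ⟨s, f, hf, fun i => ?_, hz'⟩
  have h1 := h.proj_map z i
  rw [hz, hfz, map_zero] at h1
  have h2 : Q.cls (i + d) (f i) (h.high i (hf i)) = Q.cls (i + d) 0 (zero_mem _) := h1.symm
  simpa using Q.cls_eq_cls.mp h2

lemma Maps.injective (h : Maps P Q d) (hi : ∀ i, P.high i ⊓ Q.low (i + d) ≤ P.low i) :
    Function.Injective h.map := by
  rw [injective_iff_map_eq_zero]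
  intro z hz
  obtain ⟨s, f, hf, hf', rfl⟩ := h.exists_of_mem_ker hz
  exact Finset.sum_eq_zero fun i _ => P.tot_eq_zero (hi i ⟨hf i, hf' i⟩)

lemma Maps.range_eq_ker (h : Maps P Q d) (h' : Maps Q T 0)
    (hlow : ∀ i, P.high i ≤ T.low (i + d))
    (he : ∀ i, Q.high (i + d) ⊓ T.low (i + d) ≤ P.high i ⊔ Q.low (i + d))
    (he' : ∀ i < d, Q.high i ⊓ T.low i ≤ Q.low i) :
    LinearMap.range h.map = LinearMap.ker h'.map := by
  refine le_antisymm ?_ fun z hz => ?_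
  · rintro _ ⟨z, rfl⟩
    refine P.total_induction (LinearMap.ker (h'.map ∘ₗ h.map)).toAddSubgroup (fun i m hm => ?_) z
    change h'.map (h.map (P.tot i m hm)) = 0
    rw [h.map_tot, h'.map_tot]
    exact T.tot_eq_zero (hlow i hm)
  · obtain ⟨s, f, hf, hf', rfl⟩ := h'.exists_of_mem_ker hz
    refine Submodule.sum_mem _ fun i _ => ?_
    rcases lt_or_ge i d with hi | hi
    · rw [Q.tot_eq_zero (he' i hi ⟨hf i, hf' i⟩)]
      exact zero_mem _
    · obtain ⟨j, rfl⟩ := Nat.exists_eq_add_of_le' hi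
      obtain ⟨y, hy, y', hy', hyy⟩ := Submodule.mem_sup.mp (he j ⟨hf _, hf' _⟩)
      refine ⟨P.tot j y hy, ?_⟩
      rw [h.map_tot, Q.tot_congr (m' := y + y') rfl hyy.symm
          (hm' := add_mem (h.high j hy) (Q.low_le_high _ hy')),
        Q.tot_add (h.high j hy) (Q.low_le_high _ hy'), Q.tot_eq_zero hy', add_zero]

/-- The subspaces of `M` underlying `P`, `Q`, `T` give a short exact sequence
`0 → P[-d] → Q → T → 0`. -/
structure ShortExact (P Q T : Subquotients W M) (d : ℕ) : Prop where
  maps : Maps P Q d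
  maps' : Maps Q T 0
  injective : ∀ i, P.high i ⊓ Q.low (i + d) ≤ P.low i
  surjective : ∀ i, T.high i ≤ Q.high i ⊔ T.low i
  le_low : ∀ i, P.high i ≤ T.low (i + d)
  exact : ∀ i, Q.high (i + d) ⊓ T.low (i + d) ≤ P.high i ⊔ Q.low (i + d)
  -- In degrees below `d` nothing arrives from `P[-d]`, so there the map from `Q` to `T` must be
  -- injective.
  exact' : ∀ i < d, Q.high i ⊓ T.low i ≤ Q.low i

namespace ShortExact

variable (h : ShortExact P Q T d)
include h

lemma injective_map : Function.Injective h.maps.map := h.maps.injective h.injective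

lemma surjective_map : Function.Surjective h.maps'.map :=
  h.maps'.surjective (fun i => h.surjective i) (by simp)

lemma range_eq_ker : LinearMap.range h.maps.map = LinearMap.ker h.maps'.map :=
  h.maps.range_eq_ker h.maps' h.le_low h.exact h.exact'

lemma finite_right (hQ : Module.Finite W.Gr Q.Total) : Module.Finite W.Gr T.Total :=
  Module.Finite.of_surjective _ h.surjective_map

lemma right (hQ : Q.IsFinitelyPresented) (hP : P.IsFinitelyPresented) :
    T.IsFinitelyPresented := by
  have : Module.FinitePresentation W.Gr Q.Total := hQ
  have : Module.FinitePresentation W.Gr P.Total := hP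
  refine Module.finitePresentation_of_surjective _ h.surjective_map ?_
  rw [← h.range_eq_ker, ← Submodule.map_top]
  exact Module.Finite.fg_top.map _

lemma middle (hP : P.IsFinitelyPresented) (hT : T.IsFinitelyPresented) :
    Q.IsFinitelyPresented := by
  have : Module.FinitePresentation W.Gr T.Total := hT
  have : Module.FinitePresentation W.Gr P.Total := hP
  have : Module.FinitePresentation W.Gr (LinearMap.ker h.maps'.map) := by
    rw [← h.range_eq_ker]
    exact .of_equiv (LinearEquiv.ofInjective _ h.injective_map)
  exact Module.finitePresentation_of_ker _ h.surjective_map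

/-- The kernel of a surjection onto a finitely presented module is finitely generated; coherence,
applied inside `Q`, upgrades this to finite presentation. -/
lemma left (hW : IsLeftCoherent W.Gr) (hQ : Q.IsFinitelyPresented)
    (hT : T.IsFinitelyPresented) : P.IsFinitelyPresented := by
  have : Module.FinitePresentation W.Gr T.Total := hT
  have : Module.FinitePresentation W.Gr Q.Total := hQ
  have : Module.Finite W.Gr P.Total := by
    have h1 := Module.FinitePresentation.fg_ker _ h.surjective_map
    rw [← h.range_eq_ker] at h1
    have := Module.Finite.iff_fg.mpr h1
    exact Module.Finite.equiv (LinearEquiv.ofInjective _ h.injective_map).symm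
  exact hW.finitePresentation_of_injective _ h.injective_map

end ShortExact

lemma Maps.isFinitelyPresented (h : Maps P Q d) (hW : IsLeftCoherent W.Gr)
    (hi : ∀ i, P.high i ⊓ Q.low (i + d) ≤ P.low i) (hQ : Q.IsFinitelyPresented)
    (hP : Module.Finite W.Gr P.Total) : P.IsFinitelyPresented := by
  have : Module.FinitePresentation W.Gr Q.Total := hQ
  exact hW.finitePresentation_of_injective _ (h.injective hi)

lemma Maps.isFinitelyPresented_of_bijective (h : Maps P Q d)
    (hi : ∀ i, P.high i ⊓ Q.low (i + d) ≤ P.low i)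
    (hs : ∀ i, Q.high (i + d) ≤ P.high i ⊔ Q.low (i + d))
    (hs' : ∀ i < d, Q.high i ≤ Q.low i) (hP : P.IsFinitelyPresented) :
    Q.IsFinitelyPresented := by
  have : Module.FinitePresentation W.Gr P.Total := hP
  exact .of_equiv (LinearEquiv.ofBijective h.map ⟨h.injective hi, h.surjective hs hs'⟩)

end Subquotients

end GradedMaps

/-! ### Subquotients comparing two filtrations, and interpolating filtrations. -/

section Interpolation

variable {K R M : Type*} [CommRing K] [Ring R] [Algebra K R]
  [AddCommGroup M] [Module K M] [Module R M] {W : RingFiltration K R}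

lemma zext_le_zext {P Q : ℕ → Submodule K M} (h : ∀ i, P i ≤ Q i) (j : ℤ) :
    zext P j ≤ zext Q j := by
  cases j with
  | ofNat i => exact h i
  | negSucc i => exact le_rfl

namespace ModuleFiltration

/-- `⨁ i, (A_{i+c} ∩ B_i) / (A_{i+c-1} ∩ B_i)`. -/
def shiftedU (A B : ModuleFiltration W M) (c : ℕ) : Subquotients W M where
  high i := zext A.piece ((i : ℤ) + c) ⊓ zext B.piece (i : ℤ)
  low i := zext A.piece ((i : ℤ) + c - 1) ⊓ zext B.piece (i : ℤ)
  low_le_high i := inf_le_inf (zext_mono A.mono (by omega)) le_rfl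
  smul_high {l i _ _} hx hm :=
    ⟨A.smul_mem_zext (a := (l : ℤ)) hx hm.1 (by push_cast; ring),
      B.smul_mem_zext (a := (l : ℤ)) hx hm.2 (by push_cast; ring)⟩
  smul_low {l i _ _} hx hm :=
    ⟨A.smul_mem_zext (a := (l : ℤ)) hx hm.1 (by push_cast; ring),
      B.smul_mem_zext (a := (l : ℤ)) hx hm.2 (by push_cast; ring)⟩
  prev_smul_high {l i _ _} hx hm :=
    ⟨A.smul_mem_zext hx hm.1 (by push_cast; ring),
      zext_mono B.mono (by push_cast; omega) (B.smul_mem_zext hx hm.2 rfl)⟩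

/-- `⨁ i, B_i / (A_{i+c} ∩ B_i + B_{i-1})`. -/
def coV (A B : ModuleFiltration W M) (c : ℕ) : Subquotients W M where
  high i := zext B.piece (i : ℤ)
  low i := (zext A.piece ((i : ℤ) + c) ⊓ zext B.piece (i : ℤ)) ⊔ zext B.piece ((i : ℤ) - 1)
  low_le_high i := sup_le inf_le_right (zext_mono B.mono (by omega))
  smul_high {l i _ _} hx hm := B.smul_mem_zext (a := (l : ℤ)) hx hm (by push_cast; ring)
  smul_low {l i x m} hx hm := by
    obtain ⟨u, hu, v, hv, rfl⟩ := Submodule.mem_sup.mp hm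
    rw [smul_add]
    refine Submodule.add_mem_sup ⟨?_, ?_⟩ ?_
    · exact A.smul_mem_zext (a := (l : ℤ)) hx hu.1 (by push_cast; ring)
    · exact B.smul_mem_zext (a := (l : ℤ)) hx hu.2 (by push_cast; ring)
    · exact B.smul_mem_zext (a := (l : ℤ)) hx hv (by push_cast; ring)
  prev_smul_high {l i x m} hx hm :=
    Submodule.mem_sup_right (B.smul_mem_zext hx hm (by push_cast; ring))

variable (A B : ModuleFiltration W M)

lemma shortExact_V_grDiag (c : ℕ) :
    Subquotients.ShortExact (A.V B c) (A.V B (c + 1)) (A.grDiag B (c + 1)) 0 where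
  maps :=
    { high := fun i _ hm => ⟨zext_mono A.mono (by push_cast; omega) hm.1, hm.2⟩
      low := fun i _ hm => ⟨zext_mono A.mono (by push_cast; omega) hm.1, hm.2⟩ }
  maps' :=
    { high := fun _ _ hm => hm
      low := fun _ _ hm => Submodule.mem_sup_right hm }
  injective i m hm := ⟨hm.1.1, hm.2.2⟩
  surjective i := le_sup_left
  le_low i m hm := Submodule.mem_sup_left ⟨zext_mono A.mono (by push_cast; omega) hm.1, hm.2⟩
  exact i := inf_le_right.trans
    (sup_le_sup (inf_le_inf (zext_mono A.mono (by push_cast; omega)) le_rfl) le_rfl)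
  exact' := by simp

lemma shortExact_shiftedU_grDiag (c : ℕ) :
    Subquotients.ShortExact (A.shiftedU B (c + 1)) (A.shiftedU B c) (A.grDiag B c) 1 where
  maps :=
    { high := fun i _ hm => ⟨zext_mono A.mono (by push_cast; omega) hm.1,
        zext_mono B.mono (by push_cast; omega) hm.2⟩
      low := fun i _ hm => ⟨zext_mono A.mono (by push_cast; omega) hm.1,
        zext_mono B.mono (by push_cast; omega) hm.2⟩ }
  maps' :=
    { high := fun _ _ hm => hm
      low := fun _ _ hm => Submodule.mem_sup_left hm }
  injective i m hm := ⟨zext_mono A.mono (by push_cast; omega) hm.2.1, hm.1.2⟩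
  surjective i := le_sup_left
  le_low i m hm := Submodule.mem_sup_right
    ⟨zext_mono A.mono (by push_cast; omega) hm.1, zext_mono B.mono (by push_cast; omega) hm.2⟩
  exact i := by
    refine inf_le_right.trans (sup_le le_sup_right (le_sup_of_le_left ?_))
    exact inf_le_inf (zext_mono A.mono (by push_cast; omega))
      (zext_mono B.mono (by push_cast; omega))
  exact' i hi := by
    obtain rfl : i = 0 := by omega
    refine inf_le_right.trans (sup_le le_rfl (inf_le_right.trans ?_))
    rw [zext_of_neg _ (by simp)]
    exact bot_le

lemma shortExact_V_gr_coV (c : ℕ) :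
    Subquotients.ShortExact (A.V B c) B.gr (A.coV B c) 0 where
  maps :=
    { high := fun i _ hm => hm.2
      low := fun i _ hm => hm.2 }
  maps' :=
    { high := fun _ _ hm => hm
      low := fun _ _ hm => Submodule.mem_sup_right hm }
  injective i m hm := ⟨hm.1.1, hm.2⟩
  surjective i := le_sup_left
  le_low i m hm := Submodule.mem_sup_left hm
  exact i := inf_le_right
  exact' := by simp

lemma maps_grDiag_coV (c : ℕ) :
    Subquotients.Maps (A.grDiag B (c + 1)) (A.coV B c) 0 where
  high _ _ hm := hm.2
  low i := sup_le_sup (inf_le_inf (zext_mono A.mono (by push_cast; omega)) le_rfl) inf_le_right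

/-- This is the modular law: in `y + z` with `y ∈ A_{i+c}` and `z ∈ B_{i-1}`, membership of the sum
in `A_{i+c+1}` forces `z ∈ A_{i+c+1}`. -/
lemma maps_grDiag_coV_injective (c i : ℕ) :
    (A.grDiag B (c + 1)).high i ⊓ (A.coV B c).low (i + 0) ≤ (A.grDiag B (c + 1)).low i := by
  rintro x ⟨hx, hx'⟩
  obtain ⟨y, hy, z, hz, rfl⟩ := Submodule.mem_sup.mp hx'
  have hy1 : y ∈ zext A.piece ((i : ℤ) + (c + 1 : ℕ) - 1) :=
    zext_mono A.mono (by push_cast; omega) hy.1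
  refine Submodule.add_mem_sup ⟨hy1, hy.2⟩ ⟨?_, hz⟩
  exact (Submodule.add_mem_iff_right _ (zext_mono A.mono (by omega) hy1)).mp hx.1

variable {A B}

/-- As `A_{i-1} ⊆ B_{i-1}`, the denominator for `c = 0` is `A_i ∩ B_{i-1}`. So `grDiag` embeds in
`gr_B`, while being a quotient of `shiftedU`. -/
lemma grDiag_zero_isFinitelyPresented (hW : IsLeftCoherent W.Gr)
    (hAB : ∀ i, A.piece i ≤ B.piece i) (hB : B.gr.IsFinitelyPresented)
    (hU : (A.shiftedU B 0).IsFinitelyPresented) : (A.grDiag B 0).IsFinitelyPresented := by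
  have hm : Subquotients.Maps (A.grDiag B 0) B.gr 0 :=
    { high := fun _ _ hm => hm.2
      low := fun i => sup_le
        ((inf_le_left.trans (zext_le_zext hAB _)).trans (zext_mono B.mono (by push_cast; omega)))
        inf_le_right }
  refine hm.isFinitelyPresented hW (fun i x hx => Submodule.mem_sup_right ⟨hx.1.1, hx.2⟩) hB ?_
  have : Module.FinitePresentation W.Gr (A.shiftedU B 0).Total := hU
  exact (shortExact_shiftedU_grDiag A B 0).finite_right inferInstance

lemma V_zero_isFinitelyPresented (hAB : ∀ i, A.piece i ≤ B.piece i)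
    (hG : (A.grDiag B 0).IsFinitelyPresented) : (A.V B 0).IsFinitelyPresented := by
  have hlow : ∀ i, (A.grDiag B 0).low i ≤ (A.V B 0).low i := fun i =>
    sup_le (le_inf (inf_le_left.trans (zext_mono A.mono (by omega)))
      ((inf_le_left.trans (zext_le_zext hAB _)).trans (zext_mono B.mono (by push_cast; omega))))
      le_rfl
  have hm : Subquotients.Maps (A.grDiag B 0) (A.V B 0) 0 := ⟨fun _ => le_rfl, hlow⟩
  exact hm.isFinitelyPresented_of_bijective (fun i x hx => Submodule.mem_sup_right hx.2)
    (fun i => le_sup_left) (by simp) hG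

lemma shiftedU_zero_isFinitelyPresented (hAB : ∀ i, A.piece i ≤ B.piece i)
    (hA : A.gr.IsFinitelyPresented) : (A.shiftedU B 0).IsFinitelyPresented := by
  have hm : Subquotients.Maps A.gr (A.shiftedU B 0) 0 :=
    { high := fun i x hx => ⟨zext_mono A.mono (a := (i : ℤ)) (by push_cast; omega) hx, hAB i hx⟩
      low := fun i x hx => ⟨zext_mono A.mono (by push_cast; omega) hx,
        zext_mono B.mono (by push_cast; omega) (zext_le_zext hAB _ hx)⟩ }
  refine hm.isFinitelyPresented_of_bijective ?_ ?_ (by simp) hA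
  · exact fun i x hx => zext_mono A.mono (by push_cast; omega) hx.2.1
  · exact fun i x hx => Submodule.mem_sup_left
      (zext_mono A.mono (b := (i : ℤ)) (by push_cast; omega) hx.1)

/-- If `A_i ⊆ B_i` for all `i` and `gr_A(M)`, `gr_B(M)` are finitely presented over a coherent
associated graded ring, so are all the subquotients measuring the difference of `A` and `B`. -/
theorem isFinitelyPresented_subquotients (hW : IsLeftCoherent W.Gr)
    (hAB : ∀ i, A.piece i ≤ B.piece i)
    (hA : A.gr.IsFinitelyPresented) (hB : B.gr.IsFinitelyPresented) (c : ℕ) :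
    (A.shiftedU B c).IsFinitelyPresented ∧ (A.grDiag B c).IsFinitelyPresented ∧
      (A.V B c).IsFinitelyPresented := by
  induction c with
  | zero =>
    have hU := shiftedU_zero_isFinitelyPresented hAB hA
    have hG := grDiag_zero_isFinitelyPresented hW hAB hB hU
    exact ⟨hU, hG, V_zero_isFinitelyPresented hAB hG⟩
  | succ c ih =>
    obtain ⟨hU, hG, hV⟩ := ih
    have hU' := (shortExact_shiftedU_grDiag A B c).left hW hU hG
    have hQ := (shortExact_V_gr_coV A B c).right hB hV
    -- Finitely generated as a quotient of `shiftedU` and embedded in the finitely presented `coV`;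
    -- coherence then applies.
    have hG' : (A.grDiag B (c + 1)).IsFinitelyPresented := by
      refine (maps_grDiag_coV A B c).isFinitelyPresented hW (maps_grDiag_coV_injective A B c) hQ ?_
      have : Module.FinitePresentation W.Gr (A.shiftedU B (c + 1)).Total := hU'
      exact (shortExact_shiftedU_grDiag A B (c + 1)).finite_right inferInstance
    exact ⟨hU', hG', (shortExact_V_grDiag A B c).middle hV hG'⟩

/-- Substituting `i + (g - k)` for `i` turns `U` into `shiftedU`. In degrees below `g - k` the index
of `B` is negative, so `U` vanishes there. -/
lemma U_isFinitelyPresented {g k : ℕ} (hk : k ≤ g)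
    (h : (A.shiftedU B (g - k)).IsFinitelyPresented) : (A.U B g k).IsFinitelyPresented := by
  have hm : Subquotients.Maps (A.shiftedU B (g - k)) (A.U B g k) (g - k) :=
    { high := fun i x hx => ⟨zext_mono A.mono (by push_cast; omega) hx.1,
        zext_mono B.mono (by push_cast [hk]; omega) hx.2⟩
      low := fun i x hx => ⟨zext_mono A.mono (by push_cast; omega) hx.1,
        zext_mono B.mono (by push_cast [hk]; omega) hx.2⟩ }
  refine hm.isFinitelyPresented_of_bijective ?_ ?_ ?_ h
  · exact fun i x hx => ⟨zext_mono A.mono (by push_cast; omega) hx.2.1, hx.1.2⟩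
  · exact fun i x hx => Submodule.mem_sup_left ⟨zext_mono A.mono (by push_cast; omega) hx.1,
      zext_mono B.mono (by push_cast [hk]; omega) hx.2⟩
  · intro i hi x hx
    have h2 : x ∈ zext B.piece ((i : ℤ) + k - g) := hx.2
    rw [zext_of_neg _ (by omega), Submodule.mem_bot] at h2
    rw [h2]
    exact zero_mem _

variable (A B) in
lemma zext_interpolating (a : ℕ) (j : ℤ) :
    zext (A.interpolating B a).piece j = zext A.piece (j + a) ⊓ zext B.piece j := by
  rcases lt_or_ge j 0 with hj | hj
  · rw [zext_of_neg _ hj, zext_of_neg _ hj, inf_bot_eq]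
  · lift j to ℕ using hj
    rfl

lemma gr_interpolating_isFinitelyPresented (hW : IsLeftCoherent W.Gr)
    (hAB : ∀ i, A.piece i ≤ B.piece i)
    (hA : A.gr.IsFinitelyPresented) (hB : B.gr.IsFinitelyPresented) (a : ℕ) :
    (A.interpolating B a).gr.IsFinitelyPresented := by
  have hhigh : ∀ i : ℕ, (A.interpolating B a).gr.high i =
    zext A.piece ((i : ℤ) + a) ⊓ zext B.piece (i : ℤ) := fun i => zext_interpolating A B a i
  have hlow : ∀ i : ℕ, (A.interpolating B a).gr.low i =
    zext A.piece ((i : ℤ) - 1 + a) ⊓ zext B.piece ((i : ℤ) - 1) :=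
      fun i => zext_interpolating A B a (i - 1)
  have key := isFinitelyPresented_subquotients hW hAB hA hB
  cases a with
  | zero =>
    have hm : Subquotients.Maps (A.shiftedU B 0) (A.interpolating B 0).gr 0 :=
      { high := fun i => by rw [hhigh]; exact le_rfl
        low := fun i x hx => by
          rw [hlow]
          have hx1 : x ∈ zext A.piece ((i : ℤ) - 1) := zext_mono A.mono (by push_cast; omega) hx.1
          exact ⟨zext_mono A.mono (by push_cast; omega) hx1,
            zext_mono B.mono (by push_cast; omega) (zext_le_zext hAB _ hx1)⟩ }
    refine hm.isFinitelyPresented_of_bijective (fun i x hx => ?_) (fun i => ?_) (by simp)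
      (key 0).1
    · rw [hlow] at hx
      exact ⟨zext_mono A.mono (by push_cast; omega) hx.2.1, hx.1.2⟩
    · rw [hhigh]
      exact le_sup_left
  | succ a =>
    -- The intermediate space `A_{i+a} ∩ B_i` between `T_{i-1} = A_{i+a} ∩ B_{i-1}` and `T_i =
    -- A_{i+a+1} ∩ B_i` splits the graded piece into a `V` part and a `shiftedU` part.
    have hex : Subquotients.ShortExact (A.V B a) (A.interpolating B (a + 1)).gr
        (A.shiftedU B (a + 1)) 0 :=
      { maps :=
          { high := fun i x hx => by
              rw [hhigh]
              exact ⟨zext_mono A.mono (by push_cast; omega) hx.1, hx.2⟩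
            low := fun i x hx => by
              rw [hlow]
              exact ⟨zext_mono A.mono (by push_cast; omega) hx.1, hx.2⟩ }
        maps' :=
          { high := fun i => by rw [hhigh]; exact le_rfl
            low := fun i x hx => by
              rw [hlow] at hx
              exact ⟨zext_mono A.mono (by push_cast; omega) hx.1,
                zext_mono B.mono (by push_cast; omega) hx.2⟩ }
        injective := fun i x hx => by
          rw [hlow] at hx
          exact ⟨hx.1.1, hx.2.2⟩
        surjective := fun i => by rw [hhigh]; exact le_sup_left
        le_low := fun i x hx => ⟨zext_mono A.mono (by push_cast; omega) hx.1, hx.2⟩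
        exact := fun i x hx => Submodule.mem_sup_left
          ⟨zext_mono A.mono (by push_cast; omega) hx.2.1, hx.2.2⟩
        exact' := by simp }
    exact hex.middle (key a).2.2 (key (a + 1)).1

lemma IsGreat.interpolating [IsNoetherianRing K] (hW : IsLeftCoherent W.Gr) (hA : A.IsGreat)
    (hB : B.IsGreat) (hAB : ∀ i, A.piece i ≤ B.piece i) (a : ℕ) :
    (A.interpolating B a).IsGreat := by
  refine ⟨fun i => ?_, gr_interpolating_isFinitelyPresented hW hAB hA.2 hB.2 a⟩
  have := hB.1 i
  exact Module.Finite.iff_fg.mpr (isNoetherian_submodule.mp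
    (isNoetherian_of_fg_of_noetherian _ (Module.Finite.iff_fg.mp this)) _ inf_le_right)

end ModuleFiltration

end Interpolation

/-! ### The decomposition of the ring of Frobenius operators as `𝔽_p[x] ⊕ ⨁ α, x ^ α F R`. -/

noncomputable section FrobRing

variable (p n : ℕ)

lemma letter_x_mul_comm (i j : Fin n) :
    letter p n (.x i) * letter p n (.x j) = letter p n (.x j) * letter p n (.x i) := by
  simpa [letter] using RingQuot.mkAlgHom_rel (ZMod p) (FrobRel.comm (p := p) i j)

lemma letter_x_pow_mul_letter_F (i : Fin n) :
    letter p n (.x i) ^ p * letter p n .F = letter p n .F * letter p n (.x i) := by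
  simpa [letter] using RingQuot.mkAlgHom_rel (ZMod p) (FrobRel.frob (p := p) i)

/-- The homomorphism from `𝔽_p[x_1, …, x_n]` to the ring of Frobenius operators. -/
def ofMvPolynomial : MvPolynomial (Fin n) (ZMod p) →ₐ[ZMod p] FrobRing p n :=
  have := Algebra.isMulCommutative_adjoin (ZMod p) (s := Set.range fun i => letter p n (.x i)) (by
    rintro _ ⟨i, rfl⟩ _ ⟨j, rfl⟩
    exact letter_x_mul_comm p n i j)
  let _ : CommRing (Algebra.adjoin (ZMod p) (Set.range fun i => letter p n (.x i))) :=
    { Subalgebra.toRing _ with mul_comm := this.is_comm.comm }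
  (Algebra.adjoin (ZMod p) (Set.range fun i => letter p n (.x i))).val.comp
    (MvPolynomial.aeval fun i => ⟨letter p n (.x i), Algebra.subset_adjoin ⟨i, rfl⟩⟩)

lemma ofMvPolynomial_X (i : Fin n) :
    ofMvPolynomial p n (MvPolynomial.X i) = letter p n (.x i) := by
  simp [ofMvPolynomial]

variable {p n}

lemma letter_mem_piece (s : Letter n) : letter p n s ∈ (bernsteinFiltration p n).piece 1 :=
  Submodule.subset_span ⟨[s], le_rfl, by simp⟩

lemma prod_letter_mem_piece (l : List (Letter n)) :
    (l.map (letter p n)).prod ∈ (bernsteinFiltration p n).piece l.length :=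
  Submodule.subset_span ⟨l, le_rfl, rfl⟩

/-- The monomial `x ^ α` with exponents the least nonnegative residues of `α`. -/
def boxMonomial (α : Fin n → ZMod p) : MvPolynomial (Fin n) (ZMod p) :=
  ∏ i, MvPolynomial.X i ^ (α i).val

/-- The degree of `boxMonomial α`. -/
def boxDegree (α : Fin n → ZMod p) : ℕ := ∑ i, (α i).val

/-- The factor `x_i` appearing when the exponent of `x_i` wraps around. -/
def carry (i : Fin n) (c : ZMod p) : FrobRing p n := if c = 0 then letter p n (.x i) else 1

lemma val_add_one_of_ne [NeZero p] {c : ZMod p} (h : c + 1 ≠ 0) : (c + 1).val = c.val + 1 := by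
  have hc : c.val + 1 < p := by
    rcases lt_or_ge (c.val + 1) p with h1 | h1
    · exact h1
    · have h2 : c.val + 1 = p := le_antisymm (ZMod.val_lt c) h1
      refine absurd ?_ h
      rw [← ZMod.natCast_zmod_val c, ← Nat.cast_one, ← Nat.cast_add, h2, ZMod.natCast_self]
  conv_lhs => rw [← ZMod.natCast_zmod_val c, ← Nat.cast_one, ← Nat.cast_add]
  exact ZMod.val_cast_of_lt hc

lemma val_add_one_of_eq [NeZero p] {c : ZMod p} (h : c + 1 = 0) : c.val + 1 = p := by
  have h1 : p ∣ c.val + 1 := by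
    rw [← ZMod.natCast_eq_zero_iff]
    simpa using h
  exact le_antisymm (ZMod.val_lt c) (Nat.le_of_dvd (Nat.succ_pos _) h1)

lemma boxMonomial_add_single [NeZero p] {α : Fin n → ZMod p} {i : Fin n} (h : α i + 1 ≠ 0) :
    boxMonomial (α + Pi.single i 1) = MvPolynomial.X i * boxMonomial α := by
  unfold boxMonomial
  rw [← Finset.mul_prod_erase _ _ (Finset.mem_univ i),
    ← Finset.mul_prod_erase _ _ (Finset.mem_univ i),
    ← mul_assoc, ← pow_succ']
  congr 1
  · simp [val_add_one_of_ne h]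
  · refine Finset.prod_congr rfl fun j hj => ?_
    simp [Finset.ne_of_mem_erase hj]

lemma X_mul_boxMonomial [NeZero p] {α : Fin n → ZMod p} {i : Fin n} (h : α i + 1 = 0) :
    MvPolynomial.X i * boxMonomial α =
      boxMonomial (α + Pi.single i 1) * MvPolynomial.X i ^ p := by
  unfold boxMonomial
  rw [← Finset.mul_prod_erase _ _ (Finset.mem_univ i),
    ← Finset.mul_prod_erase _ _ (Finset.mem_univ i),
    ← mul_assoc, ← pow_succ', val_add_one_of_eq h, mul_comm]
  congr 1
  simp only [Pi.add_apply, Pi.single_eq_same, h, ZMod.val_zero, pow_zero, one_mul]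
  refine Finset.prod_congr rfl fun j hj => ?_
  simp [Finset.ne_of_mem_erase hj]

lemma boxDegree_add_single [NeZero p] {α : Fin n → ZMod p} {i : Fin n} (h : α i + 1 ≠ 0) :
    boxDegree (α + Pi.single i 1) = boxDegree α + 1 := by
  unfold boxDegree
  rw [← Finset.add_sum_erase _ _ (Finset.mem_univ i),
    ← Finset.add_sum_erase _ _ (Finset.mem_univ i),
    Finset.sum_congr rfl fun j hj => by
      rw [Pi.add_apply, Pi.single_eq_of_ne (Finset.ne_of_mem_erase hj), add_zero]]
  simp [val_add_one_of_ne h]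
  ring

lemma boxDegree_add_single_of_eq [NeZero p] {α : Fin n → ZMod p} {i : Fin n} (h : α i + 1 = 0) :
    boxDegree (α + Pi.single i 1) + p = boxDegree α + 1 := by
  unfold boxDegree
  rw [← Finset.add_sum_erase _ _ (Finset.mem_univ i),
    ← Finset.add_sum_erase _ _ (Finset.mem_univ i),
    Finset.sum_congr rfl fun j hj => by
      rw [Pi.add_apply, Pi.single_eq_of_ne (Finset.ne_of_mem_erase hj), add_zero]]
  have := val_add_one_of_eq h
  simp [h]
  omega

lemma boxDegree_zero : boxDegree (0 : Fin n → ZMod p) = 0 := by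
  simp [boxDegree]

lemma boxMonomial_zero : boxMonomial (0 : Fin n → ZMod p) = 1 := by
  simp [boxMonomial]

/-- The operator `x ^ α ⊗ r ↦ x_i x ^ α ⊗ r` on `𝔽_p[x] ⊗ R`, the tensor product being formed
along the Frobenius of `𝔽_p[x]` and identified with functions on the box of exponents. -/
def boxShift (i : Fin n) : ((Fin n → ZMod p) → FrobRing p n) →ₗ[ZMod p]
    ((Fin n → ZMod p) → FrobRing p n) where
  toFun r α := carry i (α i) * r (α - Pi.single i 1)
  map_add' r r' := by ext; simp [mul_add]
  map_smul' c r := by ext; simp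

lemma boxShift_single (i : Fin n) (α : Fin n → ZMod p) (y : FrobRing p n) :
    boxShift i (Pi.single α y) = Pi.single (α + Pi.single i 1) (carry i (α i + 1) * y) := by
  ext β
  change carry i (β i) * (Pi.single α y : (Fin n → ZMod p) → FrobRing p n) (β - Pi.single i 1) = _
  by_cases hβ : β = α + Pi.single i 1
  · subst hβ
    simp
  · rw [Pi.single_eq_of_ne hβ, Pi.single_eq_of_ne, mul_zero]
    rintro rfl
    simp at hβ

lemma carry_mul_comm (i j : Fin n) (c d : ZMod p) :
    carry i c * carry j d = carry j d * carry i c := by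
  unfold carry
  split_ifs <;> simp [letter_x_mul_comm]

lemma boxShift_comm (i j : Fin n) :
    boxShift (p := p) i * boxShift j = boxShift j * boxShift i := by
  rcases eq_or_ne i j with rfl | hij
  · rfl
  refine LinearMap.ext fun r => funext fun α => ?_
  change carry i (α i) * (carry j ((α - Pi.single i 1 : Fin n → ZMod p) j) *
      r (α - Pi.single i 1 - Pi.single j 1)) =
    carry j (α j) * (carry i ((α - Pi.single j 1 : Fin n → ZMod p) i) *
      r (α - Pi.single j 1 - Pi.single i 1))
  rw [Pi.sub_apply, Pi.sub_apply, Pi.single_eq_of_ne hij, Pi.single_eq_of_ne hij.symm, sub_zero,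
    sub_zero, ← mul_assoc, ← mul_assoc, carry_mul_comm, sub_right_comm]

lemma boxShift_pow_single [NeZero p] (i : Fin n) {α : Fin n → ZMod p} (hα : α i = 0)
    (y : FrobRing p n) {t : ℕ} (ht : t < p) :
    (boxShift i ^ t) (Pi.single α y) = Pi.single (α + Pi.single i (t : ZMod p)) y := by
  induction t with
  | zero => simp
  | succ t ih =>
    have h0 : ((t : ZMod p) + 1) ≠ 0 := by
      rw [← Nat.cast_one, ← Nat.cast_add, Ne, ZMod.natCast_eq_zero_iff]
      exact Nat.not_dvd_of_pos_of_lt (Nat.succ_pos _) ht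
    rw [pow_succ', Module.End.mul_apply, ih (by omega), boxShift_single]
    rw [add_assoc, ← Pi.single_add]
    simp [hα, carry, h0]

/-- The first `p - 1` shifts stay inside the box; the last one wraps around and contributes the
single factor `x_i`. This is the relation `x_i ^ p F = F x_i` in the model. -/
lemma boxShift_pow_prime_single [NeZero p] (i : Fin n) (y : FrobRing p n) :
    (boxShift i ^ p) (Pi.single 0 y) = Pi.single 0 (letter p n (.x i) * y) := by
  obtain ⟨q, hq⟩ : ∃ q, p = q + 1 := ⟨p - 1, by have := NeZero.pos p; omega⟩
  have h0 : ((q : ZMod p) + 1) = 0 := by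
    rw [← Nat.cast_one, ← Nat.cast_add, ← hq, ZMod.natCast_self]
  have h1 : boxShift (p := p) i ^ p = boxShift i * boxShift i ^ q := by
    rw [← pow_succ', ← hq]
  rw [h1, Module.End.mul_apply, boxShift_pow_single i rfl y (by omega), boxShift_single,
    add_assoc, ← Pi.single_add]
  simp [h0, carry]

variable [NeZero p]

/-- The map `x ^ α ⊗ r ↦ x ^ α F r`. -/
def boxSum : ((Fin n → ZMod p) → FrobRing p n) →ₗ[ZMod p] FrobRing p n where
  toFun r := ∑ α, ofMvPolynomial p n (boxMonomial α) * letter p n .F * r α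
  map_add' r r' := by simp [mul_add, Finset.sum_add_distrib]
  map_smul' c r := by simp [Finset.smul_sum]

lemma boxSum_apply (r : (Fin n → ZMod p) → FrobRing p n) :
    boxSum r = ∑ α, ofMvPolynomial p n (boxMonomial α) * letter p n .F * r α := rfl

lemma boxSum_single (α : Fin n → ZMod p) (y : FrobRing p n) :
    boxSum (Pi.single α y) = ofMvPolynomial p n (boxMonomial α) * letter p n .F * y := by
  rw [boxSum_apply, Finset.sum_eq_single α] <;> simp +contextual

lemma boxMonomial_mul_carry (i : Fin n) (α : Fin n → ZMod p) :
    ofMvPolynomial p n (boxMonomial (α + Pi.single i 1)) * letter p n .F * carry i (α i + 1) =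
      letter p n (.x i) * (ofMvPolynomial p n (boxMonomial α) * letter p n .F) := by
  rw [← mul_assoc, ← ofMvPolynomial_X, ← map_mul]
  by_cases h : α i + 1 = 0
  · rw [X_mul_boxMonomial h, map_mul, map_pow, ofMvPolynomial_X, carry, if_pos h, mul_assoc,
      mul_assoc, letter_x_pow_mul_letter_F]
  · rw [← boxMonomial_add_single h, carry, if_neg h, mul_one]

lemma boxSum_boxShift (i : Fin n) (r : (Fin n → ZMod p) → FrobRing p n) :
    boxSum (boxShift i r) = letter p n (.x i) * boxSum r := by
  have : boxSum ∘ₗ boxShift (p := p) i =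
      LinearMap.mulLeft (ZMod p) (letter p n (.x i)) ∘ₗ boxSum := by
    refine LinearMap.pi_ext fun α y => ?_
    simp only [LinearMap.comp_apply, LinearMap.mulLeft_apply]
    rw [boxShift_single, boxSum_single, boxSum_single, ← mul_assoc, boxMonomial_mul_carry,
      mul_assoc]
  exact LinearMap.congr_fun this r

variable (p n) in
/-- The space `𝔽_p[x] ⊕ (𝔽_p[x] ⊗ R)` on which the ring `R` of Frobenius operators acts
as on itself, decomposed as `𝔽_p[x] ⊕ ⨁ α, x ^ α F R`. -/
abbrev Model : Type := MvPolynomial (Fin n) (ZMod p) × ((Fin n → ZMod p) → FrobRing p n)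

/-- The map `(f, r) ↦ f + ∑ α, x ^ α F r_α`. -/
def Model.toFrobRing : Model p n →ₗ[ZMod p] FrobRing p n :=
  (ofMvPolynomial p n).toLinearMap.coprod boxSum

/-- The action of the letters on the model. -/
def Model.letterAct : Letter n → Module.End (ZMod p) (Model p n)
  | .x i => (LinearMap.mulLeft (ZMod p) (MvPolynomial.X i)).prodMap (boxShift i)
  | .F => LinearMap.inr _ _ _ ∘ₗ LinearMap.single _ _ 0 ∘ₗ Model.toFrobRing

namespace Model

lemma toFrobRing_apply (f : MvPolynomial (Fin n) (ZMod p)) (r : (Fin n → ZMod p) → FrobRing p n) :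
    toFrobRing (f, r) = ofMvPolynomial p n f + boxSum r := by
  simp [toFrobRing]

lemma letterAct_x (i : Fin n) (f : MvPolynomial (Fin n) (ZMod p))
    (r : (Fin n → ZMod p) → FrobRing p n) :
    letterAct (.x i) (f, r) = (MvPolynomial.X i * f, boxShift i r) := rfl

lemma letterAct_F (z : Model p n) :
    letterAct .F z = ((0, Pi.single 0 (toFrobRing z)) : Model p n) := rfl

lemma toFrobRing_letterAct (s : Letter n) (z : Model p n) :
    toFrobRing (letterAct s z) = letter p n s * toFrobRing z := by
  obtain ⟨f, r⟩ := z
  cases s with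
  | x i =>
    rw [letterAct_x, toFrobRing_apply, toFrobRing_apply, boxSum_boxShift, map_mul, mul_add,
      ofMvPolynomial_X]
  | F =>
    rw [letterAct_F, toFrobRing_apply, boxSum_single, boxMonomial_zero]
    simp

lemma letterAct_x_pow (i : Fin n) (t : ℕ) (r : (Fin n → ZMod p) → FrobRing p n) :
    (letterAct (.x i) ^ t) ((0, r) : Model p n) = (0, (boxShift i ^ t) r) := by
  induction t with
  | zero => simp
  | succ t ih =>
    rw [pow_succ', pow_succ', Module.End.mul_apply, ih, letterAct_x, mul_zero]
    rfl

variable (p n) in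
/-- The action of the ring of Frobenius operators on the model. -/
def act : FrobRing p n →ₐ[ZMod p] Module.End (ZMod p) (Model p n) :=
  RingQuot.liftAlgHom (ZMod p) ⟨FreeAlgebra.lift (ZMod p) letterAct, fun {a b} h => by
    cases h with
    | comm i j =>
      simp only [map_mul, FreeAlgebra.lift_ι_apply]
      refine LinearMap.ext fun ⟨f, r⟩ => Prod.ext (mul_left_comm _ _ _) ?_
      exact LinearMap.congr_fun (boxShift_comm i j) r
    -- After `F`, only the entry at exponent `0` is nonzero, and both sides then yield `x_i` times
    -- it.
    | frob i =>
      simp only [map_mul, map_pow, FreeAlgebra.lift_ι_apply]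
      refine LinearMap.ext fun z => ?_
      rw [Module.End.mul_apply, Module.End.mul_apply, letterAct_F, letterAct_F, letterAct_x_pow,
        boxShift_pow_prime_single, toFrobRing_letterAct]⟩

lemma act_letter (s : Letter n) : act p n (letter p n s) = letterAct s := by
  simp [act, letter]

lemma toFrobRing_act (y : FrobRing p n) (z : Model p n) :
    toFrobRing (act p n y z) = y * toFrobRing z := by
  obtain ⟨y, rfl⟩ := RingQuot.mkAlgHom_surjective (ZMod p) (FrobRel p n) y
  induction y using FreeAlgebra.induction generalizing z with
  | grade0 c =>
    rw [AlgHom.commutes, AlgHom.commutes, Module.algebraMap_end_apply, map_smul, Algebra.smul_def]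
  | grade1 s =>
    have := toFrobRing_letterAct s z
    rwa [← act_letter] at this
  | mul a b ha hb => rw [map_mul, map_mul, Module.End.mul_apply, ha, hb, mul_assoc]
  | add a b ha hb => rw [map_add, map_add, LinearMap.add_apply, map_add, ha, hb, add_mul]

lemma act_ofMvPolynomial (f g : MvPolynomial (Fin n) (ZMod p)) :
    act p n (ofMvPolynomial p n f) (g, 0) = (f * g, 0) := by
  induction f using MvPolynomial.induction_on generalizing g with
  | C c =>
    rw [← MvPolynomial.algebraMap_eq, AlgHom.commutes, AlgHom.commutes]
    simp [Algebra.smul_def]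
  | add f f' h h' => simp [map_add, LinearMap.add_apply, h, h', add_mul]
  | mul_X f i h =>
    rw [map_mul, map_mul, Module.End.mul_apply, ofMvPolynomial_X, act_letter, letterAct_x, map_zero,
      h, mul_assoc]

lemma act_prod_single (s : Finset (Fin n)) (α : Fin n → ZMod p) (y : FrobRing p n) :
    act p n (ofMvPolynomial p n (∏ i ∈ s, MvPolynomial.X i ^ (α i).val)) (0, Pi.single 0 y) =
      (0, Pi.single (∑ i ∈ s, Pi.single i (α i)) y) := by
  induction s using Finset.induction_on with
  | empty => simp
  | insert i s hi ih =>
    rw [Finset.prod_insert hi, map_mul, map_mul, Module.End.mul_apply, ih, map_pow, map_pow,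
      ofMvPolynomial_X, act_letter, letterAct_x_pow,
      boxShift_pow_single i _ y (ZMod.val_lt (α i)), Finset.sum_insert hi, add_comm,
      ZMod.natCast_zmod_val]
    rw [Finset.sum_apply]
    refine Finset.sum_eq_zero fun j hj => ?_
    rw [Pi.single_eq_of_ne]
    rintro rfl
    exact hi hj

end Model

variable (p n) in
/-- The coordinates `r_α` in the decomposition `y = f + ∑ α, x ^ α F r_α`. -/
def boxCoord : FrobRing p n →ₗ[ZMod p] ((Fin n → ZMod p) → FrobRing p n) :=
  LinearMap.snd _ _ _ ∘ₗ LinearMap.applyₗ ((1, 0) : Model p n) ∘ₗ (Model.act p n).toLinearMap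

lemma boxCoord_apply (y : FrobRing p n) : boxCoord p n y = (Model.act p n y (1, 0)).2 := rfl

lemma boxCoord_ofMvPolynomial (f : MvPolynomial (Fin n) (ZMod p)) :
    boxCoord p n (ofMvPolynomial p n f) = 0 := by
  rw [boxCoord_apply, Model.act_ofMvPolynomial]

lemma Model.toFrobRing_act_one (y : FrobRing p n) :
    Model.toFrobRing (Model.act p n y (1, 0)) = y := by
  rw [Model.toFrobRing_act, Model.toFrobRing_apply]
  simp

lemma boxCoord_letter_F_mul (y : FrobRing p n) :
    boxCoord p n (letter p n .F * y) = Pi.single 0 y := by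
  rw [boxCoord_apply, map_mul, Module.End.mul_apply, Model.act_letter, Model.letterAct_F,
    Model.toFrobRing_act_one]

lemma boxCoord_letter_x_mul (i : Fin n) (y : FrobRing p n) :
    boxCoord p n (letter p n (.x i) * y) = boxShift i (boxCoord p n y) := by
  rw [boxCoord_apply, map_mul, Module.End.mul_apply, Model.act_letter]
  rfl

/-- Recovering `y` from `x ^ α F y` is what makes each `x ^ α F R` free and their sum direct. -/
lemma boxCoord_boxMonomial_mul (α : Fin n → ZMod p) (y : FrobRing p n) :
    boxCoord p n (ofMvPolynomial p n (boxMonomial α) * letter p n .F * y) = Pi.single α y := by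
  rw [boxCoord_apply, mul_assoc, map_mul, Module.End.mul_apply, map_mul, Module.End.mul_apply,
    Model.act_letter, Model.letterAct_F, Model.toFrobRing_act_one, boxMonomial,
    Model.act_prod_single, Finset.univ_sum_single]

/-- Taking the coordinate at `α` strips off the `boxDegree α + 1` letters of `x ^ α F`. A
wrap-around costs one letter `x_i` but lowers `boxDegree` by `p - 1`, so the bound survives. -/
lemma boxCoord_prod_letter_mem (l : List (Letter n)) (α : Fin n → ZMod p) :
    boxCoord p n (l.map (letter p n)).prod α ∈
      zext (bernsteinFiltration p n).piece ((l.length : ℤ) - 1 - boxDegree α) := by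
  set W := bernsteinFiltration p n
  induction l generalizing α with
  | nil =>
    have : boxCoord p n 1 = 0 := by
      have := boxCoord_ofMvPolynomial (p := p) (n := n) 1
      rwa [map_one] at this
    simp [this]
  | cons s l ih =>
    rw [List.map_cons, List.prod_cons, List.length_cons]
    cases s with
    | F =>
      rw [boxCoord_letter_F_mul]
      rcases eq_or_ne α 0 with rfl | hα
      · rw [Pi.single_eq_same, boxDegree_zero]
        exact zext_mono W.mono (a := (l.length : ℤ)) (by push_cast; omega) (prod_letter_mem_piece l)
      · rw [Pi.single_eq_of_ne hα]
        exact zero_mem _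
    | x i =>
      rw [boxCoord_letter_x_mul]
      change carry i (α i) * boxCoord p n _ (α - Pi.single i 1) ∈ _
      have hα : α = (α - Pi.single i 1) + Pi.single i 1 := (sub_add_cancel _ _).symm
      have hi : (α - Pi.single i 1 : Fin n → ZMod p) i + 1 = α i := by simp
      unfold carry
      split_ifs with h0
      · have h1 := boxDegree_add_single_of_eq (hi.trans h0)
        rw [← hα] at h1
        refine zext_mono W.mono ?_ (W.mul_mem_zext (a := (1 : ℕ)) (letter_mem_piece (.x i))
          (ih _) rfl)
        have := NeZero.pos p
        push_cast
        omega
      · have h1 := boxDegree_add_single (α := α - Pi.single i 1) (i := i) (by rwa [hi])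
        rw [← hα] at h1
        rw [one_mul]
        refine zext_mono W.mono ?_ (ih _)
        push_cast
        omega

lemma boxCoord_mem {i : ℤ} {y : FrobRing p n} (hy : y ∈ zext (bernsteinFiltration p n).piece i)
    (α : Fin n → ZMod p) : boxCoord p n y α ∈
      zext (bernsteinFiltration p n).piece (i - 1 - boxDegree α) := by
  rcases lt_or_ge i 0 with hi | hi
  · rw [zext_of_neg _ hi, Submodule.mem_bot] at hy
    simp [hy]
  lift i to ℕ using hi
  induction hy using Submodule.span_induction with
  | mem _ h =>
    obtain ⟨l, hl, rfl⟩ := h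
    exact zext_mono (bernsteinFiltration p n).mono (by omega) (boxCoord_prod_letter_mem l α)
  | zero => simp
  | add x y _ _ hx hy => simpa using add_mem hx hy
  | smul c x _ hx => simpa using Submodule.smul_mem _ c hx

end FrobRing

/-! ### Symbols, and the structure of the associated graded ring of the Bernstein filtration. -/

section Symbols

variable {K R : Type*} [CommRing K] [Ring R] [Algebra K R] (W : RingFiltration K R)

lemma RingFiltration.symbol_congr {i j : ℕ} {x y : R} {hx : x ∈ W.piece i} {hy : y ∈ W.piece j}
    (hij : i = j) (h : x = y) : W.symbol i x hx = W.symbol j y hy :=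
  W.self.tot_congr hij h

lemma RingFiltration.symbol_eq_zero {i : ℕ} {x : R} (hx : x ∈ W.piece i)
    (hx' : x ∈ zext W.piece ((i : ℤ) - 1)) : W.symbol i x hx = 0 :=
  W.self.tot_eq_zero hx'

lemma RingFiltration.symbol_zero (i : ℕ) : W.symbol i 0 (zero_mem _) = 0 :=
  W.symbol_eq_zero _ (zero_mem _)

lemma RingFiltration.symbol_add {i : ℕ} {x y : R} (hx : x ∈ W.piece i) (hy : y ∈ W.piece i) :
    W.symbol i (x + y) (add_mem hx hy) = W.symbol i x hx + W.symbol i y hy :=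
  W.self.tot_add hx hy

lemma RingFiltration.symbol_one : W.symbol 0 1 W.one_mem = 1 := rfl

end Symbols

noncomputable section Bernstein

variable {p n : ℕ}

lemma ofMvPolynomial_X_pow_mem (i : Fin n) (a : ℕ) :
    ofMvPolynomial p n (MvPolynomial.X i ^ a) ∈ (bernsteinFiltration p n).piece a := by
  induction a with
  | zero =>
    rw [pow_zero, map_one]
    exact (bernsteinFiltration p n).one_mem
  | succ a ih =>
    rw [pow_succ, map_mul, ofMvPolynomial_X]
    exact (bernsteinFiltration p n).mul_mem ih (letter_mem_piece _)

lemma ofMvPolynomial_prod_mem (s : Finset (Fin n)) (a : Fin n → ℕ) :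
    ofMvPolynomial p n (∏ i ∈ s, MvPolynomial.X i ^ a i) ∈
      (bernsteinFiltration p n).piece (∑ i ∈ s, a i) := by
  induction s using Finset.induction_on with
  | empty =>
    rw [Finset.prod_empty, map_one]
    exact (bernsteinFiltration p n).one_mem
  | insert i s hi ih =>
    rw [Finset.prod_insert hi, Finset.sum_insert hi, map_mul]
    exact (bernsteinFiltration p n).mul_mem (ofMvPolynomial_X_pow_mem i (a i)) ih

lemma ofMvPolynomial_boxMonomial_mem (α : Fin n → ZMod p) :
    ofMvPolynomial p n (boxMonomial α) ∈ (bernsteinFiltration p n).piece (boxDegree α) :=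
  ofMvPolynomial_prod_mem _ _

variable (p n) in
/-- The class of `x_i` in the associated graded ring. -/
def grX (i : Fin n) : (bernsteinFiltration p n).Gr :=
  (bernsteinFiltration p n).symbol 1 (letter p n (.x i)) (letter_mem_piece _)

variable (p n) in
/-- The subring of the associated graded ring generated by the classes of the `x_i`. -/
def grPolynomials : Subring (bernsteinFiltration p n).Gr :=
  Subring.closure (Set.range (grX p n))

/-- The class of `x ^ α F` in the associated graded ring. -/
def grBox (α : Fin n → ZMod p) : (bernsteinFiltration p n).Gr :=
  (bernsteinFiltration p n).symbol (boxDegree α + 1)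
    (ofMvPolynomial p n (boxMonomial α) * letter p n .F)
    ((bernsteinFiltration p n).mul_mem (ofMvPolynomial_boxMonomial_mem α) (letter_mem_piece _))

lemma grX_mem (i : Fin n) : grX p n i ∈ grPolynomials p n := Subring.subset_closure ⟨i, rfl⟩

/-- The generators commute, so this ring is a quotient of `ℤ[x_1, …, x_n]`, and Hilbert's basis
theorem applies. -/
instance : IsNoetherianRing (grPolynomials p n) := by
  have hcomm : IsMulCommutative (grPolynomials p n) := Subring.isMulCommutative_closure (by
    rintro _ ⟨i, rfl⟩ _ ⟨j, rfl⟩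
    unfold grX
    rw [RingFiltration.symbol_mul_symbol, RingFiltration.symbol_mul_symbol]
    exact RingFiltration.symbol_congr _ rfl (letter_x_mul_comm p n i j))
  let _ : CommRing (grPolynomials p n) :=
    { Subring.toRing _ with mul_comm := hcomm.is_comm.comm }
  let f : MvPolynomial (Fin n) ℤ →+* grPolynomials p n :=
    (MvPolynomial.aeval (R := ℤ) fun i => (⟨grX p n i, grX_mem i⟩ : grPolynomials p n)).toRingHom
  refine isNoetherianRing_of_surjective _ _ f ?_
  have hrange : grPolynomials p n ≤ f.range.map (grPolynomials p n).subtype := by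
    refine Subring.closure_le.mpr ?_
    rintro _ ⟨i, rfl⟩
    exact ⟨⟨grX p n i, grX_mem i⟩, ⟨MvPolynomial.X i, MvPolynomial.aeval_X _ i⟩, rfl⟩
  intro s
  obtain ⟨t, ⟨q, hq⟩, hts⟩ := hrange s.2
  exact ⟨q, hq.trans (Subtype.ext hts)⟩

variable [Fact p.Prime]

lemma grX_mul_grBox_of_ne {i : Fin n} {α : Fin n → ZMod p} (h : α i + 1 ≠ 0) :
    grX p n i * grBox α = grBox (α + Pi.single i 1) := by
  unfold grX grBox
  rw [RingFiltration.symbol_mul_symbol]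
  refine RingFiltration.symbol_congr _ ?_ ?_
  · rw [boxDegree_add_single h]
    ring
  · rw [boxMonomial_add_single h, map_mul, ofMvPolynomial_X, mul_assoc]

/-- The product equals `x ^ α' F x_i`, with `p - 2` fewer letters beyond the box degree than
expected plus one: its complexity is at most `boxDegree α + 3 - p`, below `boxDegree α + 2` since `p
≥ 2`. -/
lemma grX_mul_grBox_of_eq {i : Fin n} {α : Fin n → ZMod p} (h : α i + 1 = 0) :
    grX p n i * grBox α = 0 := by
  unfold grX grBox
  rw [RingFiltration.symbol_mul_symbol]
  refine RingFiltration.symbol_eq_zero _ _ ?_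
  rw [← boxMonomial_mul_carry, carry, if_pos h]
  have hdeg := boxDegree_add_single_of_eq h
  have hp : 2 ≤ p := (Fact.out : p.Prime).two_le
  refine zext_mono (bernsteinFiltration p n).mono ?_
    ((bernsteinFiltration p n).mul_mem_zext (a := (boxDegree (α + Pi.single i 1) + 1 : ℕ))
      (b := (1 : ℕ)) ((bernsteinFiltration p n).mul_mem (ofMvPolynomial_boxMonomial_mem _)
      (letter_mem_piece _)) (letter_mem_piece _) rfl)
  push_cast
  omega

lemma mul_grBox_mem_span {s : (bernsteinFiltration p n).Gr} (hs : s ∈ grPolynomials p n)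
    (α : Fin n → ZMod p) :
    s * grBox α ∈ Submodule.span ℤ (Set.range (grBox (p := p) (n := n))) := by
  suffices h : ∀ a ∈ Submodule.span ℤ (Set.range (grBox (p := p) (n := n))),
      s * a ∈ Submodule.span ℤ (Set.range (grBox (p := p) (n := n))) from
    h _ (Submodule.subset_span ⟨α, rfl⟩)
  unfold grPolynomials at hs
  induction hs using Subring.closure_induction with
  | mem x hx =>
    obtain ⟨i, rfl⟩ := hx
    intro a ha
    induction ha using Submodule.span_induction with
    | mem _ h =>
      obtain ⟨β, rfl⟩ := h
      by_cases hβ : β i + 1 = 0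
      · rw [grX_mul_grBox_of_eq hβ]
        exact zero_mem _
      · rw [grX_mul_grBox_of_ne hβ]
        exact Submodule.subset_span ⟨_, rfl⟩
    | zero => rw [mul_zero]; exact zero_mem _
    | add x y _ _ hx hy => rw [mul_add]; exact add_mem hx hy
    | smul c x _ hx => rw [mul_smul_comm]; exact Submodule.smul_mem _ c hx
  | zero => intro a _; rw [zero_mul]; exact zero_mem _
  | one => intro a ha; rwa [one_mul]
  | add x y _ _ hx hy => intro a ha; rw [add_mul]; exact add_mem (hx a ha) (hy a ha)
  | neg x _ hx => intro a ha; rw [neg_mul]; exact neg_mem (hx a ha)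
  | mul x y _ _ hx hy => intro a ha; rw [mul_assoc]; exact hx _ (hy a ha)

/-- Reading a word from the left, letters `x_i` accumulate in a prefix `s ∈ S`. At the first `F` the
product `s e_0` is an integral combination of the `e_β`, and the shorter remaining word is handled
by induction. -/
lemma gr_bernstein_induction (H : AddSubgroup (bernsteinFiltration p n).Gr)
    (hS : ∀ s ∈ grPolynomials p n, s ∈ H) (hH : ∀ α : Fin n → ZMod p, ∀ a ∈ H, grBox α * a ∈ H)
    (a : (bernsteinFiltration p n).Gr) : a ∈ H := by
  have hword : ∀ l : List (Letter n), ∀ s ∈ grPolynomials p n,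
      s * (bernsteinFiltration p n).symbol l.length (l.map (letter p n)).prod (prod_letter_mem_piece l) ∈ H := by
    intro l
    induction l with
    | nil =>
      intro s hs
      have : (bernsteinFiltration p n).symbol ([] : List (Letter n)).length (([] : List (Letter n)).map (letter p n)).prod
        (prod_letter_mem_piece []) = 1 := (bernsteinFiltration p n).symbol_one
      rw [this, mul_one]
      exact hS s hs
    | cons c l ih =>
      intro s hs
      have hc : (bernsteinFiltration p n).symbol (c :: l).length ((c :: l).map (letter p n)).prod
          (prod_letter_mem_piece (c :: l)) = (bernsteinFiltration p n).symbol 1 (letter p n c) (letter_mem_piece c) *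
            (bernsteinFiltration p n).symbol l.length (l.map (letter p n)).prod (prod_letter_mem_piece l) := by
        rw [RingFiltration.symbol_mul_symbol]
        exact (bernsteinFiltration p n).symbol_congr (by rw [List.length_cons, add_comm]) (by simp)
      rw [hc, ← mul_assoc]
      cases c with
      | x i => exact ih _ (mul_mem hs (grX_mem i))
      | F =>
        have hF : (bernsteinFiltration p n).symbol 1 (letter p n .F) (letter_mem_piece .F) =
            grBox (0 : Fin n → ZMod p) :=
          (bernsteinFiltration p n).symbol_congr (by rw [boxDegree_zero]) (by rw [boxMonomial_zero, map_one, one_mul])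
        rw [hF]
        have hspan := mul_grBox_mem_span hs 0
        generalize s * grBox (0 : Fin n → ZMod p) = b at hspan ⊢
        induction hspan using Submodule.span_induction with
        | mem _ h =>
          obtain ⟨β, rfl⟩ := h
          refine hH β _ ?_
          simpa using ih 1 (one_mem _)
        | zero => rw [zero_mul]; exact zero_mem _
        | add x y _ _ hx hy => rw [add_mul]; exact add_mem hx hy
        | smul c x _ hx => rw [smul_mul_assoc]; exact zsmul_mem hx c
  refine (bernsteinFiltration p n).gr_induction H (fun i x hx => ?_) a
  have hx' := hx
  change x ∈ Submodule.span (ZMod p) (monomialsOfComplexityLE p n i) at hx'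
  have hc : ∃ hx : x ∈ (bernsteinFiltration p n).piece i, (bernsteinFiltration p n).symbol i x hx ∈ H := by
    clear hx
    induction hx' using Submodule.closure_induction with
    | zero => exact ⟨zero_mem _, by rw [(bernsteinFiltration p n).symbol_zero]; exact zero_mem _⟩
    | add x y _ _ hx hy =>
      obtain ⟨hx, hxH⟩ := hx
      obtain ⟨hy, hyH⟩ := hy
      exact ⟨add_mem hx hy, by rw [(bernsteinFiltration p n).symbol_add hx hy]; exact add_mem hxH hyH⟩
    | smul_mem c x hx =>
      obtain ⟨l, hl, rfl⟩ := hx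
      have hlm : (l.map (letter p n)).prod ∈ (bernsteinFiltration p n).piece i := (bernsteinFiltration p n).mono hl (prod_letter_mem_piece l)
      have hlH : (bernsteinFiltration p n).symbol i (l.map (letter p n)).prod hlm ∈ H := by
        rcases eq_or_lt_of_le hl with rfl | hlt
        · simpa using hword l 1 (one_mem _)
        · rw [(bernsteinFiltration p n).symbol_eq_zero _
            (zext_mono (bernsteinFiltration p n).mono (a := (l.length : ℤ)) (by omega) (prod_letter_mem_piece l))]
          exact zero_mem _
      refine ⟨Submodule.smul_mem _ c hlm, ?_⟩
      -- `H` is only an additive group; scalars of `𝔽_p` act through natural multiples.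
      have hcs : ∀ k : ℕ, ∃ h : (k • (l.map (letter p n)).prod) ∈ (bernsteinFiltration p n).piece i,
          (bernsteinFiltration p n).symbol i (k • (l.map (letter p n)).prod) h ∈ H := by
        intro k
        induction k with
        | zero =>
          refine ⟨by rw [zero_smul]; exact zero_mem _, ?_⟩
          rw [(bernsteinFiltration p n).symbol_congr (j := i) (y := 0) (hy := zero_mem _) rfl (zero_smul _ _),
            (bernsteinFiltration p n).symbol_zero]
          exact zero_mem _
        | succ k ih =>
          obtain ⟨h, hH⟩ := ih
          refine ⟨nsmul_mem hlm _, ?_⟩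
          rw [(bernsteinFiltration p n).symbol_congr (j := i) (hy := add_mem h hlm) rfl (succ_nsmul _ _),
            (bernsteinFiltration p n).symbol_add h hlm]
          exact add_mem hH hlH
      obtain ⟨h, hH⟩ := hcs c.val
      rw [(bernsteinFiltration p n).symbol_congr (j := i) (hy := h) rfl ?_]
      · exact hH
      · rw [← Nat.cast_smul_eq_nsmul (ZMod p), ZMod.natCast_zmod_val]
  exact hc.2

/-- The map induced by `boxCoord` on the associated graded ring. -/
def grCoord (β : Fin n → ZMod p) :
    (bernsteinFiltration p n).Gr →+ (bernsteinFiltration p n).Gr :=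
  Subquotients.gradedMap (bernsteinFiltration p n).self (bernsteinFiltration p n).self
    -- The truncated subtraction is harmless: when `i < 1 + boxDegree β` the coordinate is zero by
    -- `boxCoord_mem`.
    (LinearMap.proj β ∘ₗ boxCoord p n) (fun i => i - (1 + boxDegree β))
    (fun i y hy => zext_mono (bernsteinFiltration p n).mono
      (b := ((i - (1 + boxDegree β) : ℕ) : ℤ)) (by omega) (boxCoord_mem (i := (i : ℤ)) hy β))
    (fun i y hy => zext_mono (bernsteinFiltration p n).mono (by omega) (boxCoord_mem hy β))

lemma grCoord_symbol_mem (β : Fin n → ZMod p) {i : ℕ} {y : FrobRing p n}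
    (hy : y ∈ (bernsteinFiltration p n).piece i) :
    boxCoord p n y β ∈ (bernsteinFiltration p n).piece (i - (1 + boxDegree β)) :=
  zext_mono (bernsteinFiltration p n).mono
    (b := ((i - (1 + boxDegree β) : ℕ) : ℤ)) (by omega) (boxCoord_mem (i := (i : ℤ)) hy β)

lemma grCoord_symbol (β : Fin n → ZMod p) {i : ℕ} {y : FrobRing p n}
    (hy : y ∈ (bernsteinFiltration p n).piece i) :
    grCoord β ((bernsteinFiltration p n).symbol i y hy) =
      (bernsteinFiltration p n).symbol (i - (1 + boxDegree β)) (boxCoord p n y β)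
        (grCoord_symbol_mem β hy) :=
  Subquotients.gradedMap_tot (bernsteinFiltration p n).self (bernsteinFiltration p n).self
    (LinearMap.proj β ∘ₗ boxCoord p n) (fun i => i - (1 + boxDegree β)) _ _ i y hy

/-- Elements of `S` are sums of symbols of polynomials, and polynomials have zero box coordinates.
-/
lemma grCoord_of_mem {s : (bernsteinFiltration p n).Gr} (hs : s ∈ grPolynomials p n)
    (β : Fin n → ZMod p) : grCoord β s = 0 := by
  let T : Set (bernsteinFiltration p n).Gr := {a | ∃ i f, ∃ h : ofMvPolynomial p n f ∈ (bernsteinFiltration p n).piece i,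
    a = (bernsteinFiltration p n).symbol i (ofMvPolynomial p n f) h}
  have key : ∀ a ∈ AddSubgroup.closure T, s * a ∈ AddSubgroup.closure T := by
    unfold grPolynomials at hs
    induction hs using Subring.closure_induction with
    | mem x hx =>
      obtain ⟨i, rfl⟩ := hx
      intro a ha
      induction ha using AddSubgroup.closure_induction with
      | mem _ h =>
        obtain ⟨j, f, hf, rfl⟩ := h
        refine AddSubgroup.subset_closure ⟨1 + j, MvPolynomial.X i * f, ?_, ?_⟩
        · rw [map_mul, ofMvPolynomial_X]
          exact (bernsteinFiltration p n).mul_mem (letter_mem_piece _) hf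
        · unfold grX
          rw [RingFiltration.symbol_mul_symbol]
          exact (bernsteinFiltration p n).symbol_congr rfl (by rw [map_mul, ofMvPolynomial_X])
      | zero => rw [mul_zero]; exact zero_mem _
      | add x y _ _ hx hy => rw [mul_add]; exact add_mem hx hy
      | neg x _ hx => rw [mul_neg]; exact neg_mem hx
    | zero => intro a _; rw [zero_mul]; exact zero_mem _
    | one => intro a ha; rwa [one_mul]
    | add x y _ _ hx hy => intro a ha; rw [add_mul]; exact add_mem (hx a ha) (hy a ha)
    | neg x _ hx => intro a ha; rw [neg_mul]; exact neg_mem (hx a ha)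
    | mul x y _ _ hx hy => intro a ha; rw [mul_assoc]; exact hx _ (hy a ha)
  have h1 : (1 : (bernsteinFiltration p n).Gr) ∈ AddSubgroup.closure T := by
    refine AddSubgroup.subset_closure ⟨0, 1, ?_, ?_⟩
    · rw [map_one]
      exact (bernsteinFiltration p n).one_mem
    · rw [← (bernsteinFiltration p n).symbol_one]
      exact (bernsteinFiltration p n).symbol_congr rfl (map_one _).symm
  have hle : AddSubgroup.closure T ≤ (grCoord β).ker := by
    rw [AddSubgroup.closure_le]
    rintro _ ⟨i, f, hf, rfl⟩
    refine (grCoord_symbol β hf).trans ?_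
    rw [(bernsteinFiltration p n).symbol_congr (j := i - (1 + boxDegree β)) (y := 0) (hy := zero_mem _) rfl
      (by rw [boxCoord_ofMvPolynomial]; rfl), (bernsteinFiltration p n).symbol_zero]
  have := hle (key 1 h1)
  rwa [mul_one] at this

lemma grCoord_grBox_mul (α β : Fin n → ZMod p) (a : (bernsteinFiltration p n).Gr) :
    grCoord β (grBox α * a) = if α = β then a else 0 := by
  let f : (bernsteinFiltration p n).Gr →+ (bernsteinFiltration p n).Gr := (grCoord β).comp (AddMonoidHom.mulLeft (grBox α))
  let g : (bernsteinFiltration p n).Gr →+ (bernsteinFiltration p n).Gr := if α = β then AddMonoidHom.id _ else 0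
  have hfg : f a = g a := by
    refine (bernsteinFiltration p n).gr_induction (AddMonoidHom.eqLocus f g) (fun i y hy => ?_) a
    change grCoord β (grBox α * (bernsteinFiltration p n).symbol i y hy) =
      g ((bernsteinFiltration p n).symbol i y hy)
    unfold grBox
    rw [RingFiltration.symbol_mul_symbol, grCoord_symbol]
    by_cases h : α = β
    · subst h
      simp only [g, if_true]
      exact (bernsteinFiltration p n).symbol_congr (by omega) (by rw [boxCoord_boxMonomial_mul, Pi.single_eq_same])
    · simp only [g, if_neg h]
      rw [(bernsteinFiltration p n).symbol_congr (y := 0) (hy := zero_mem _) rfl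
        (by rw [boxCoord_boxMonomial_mul, Pi.single_eq_of_ne (Ne.symm h)]), (bernsteinFiltration p n).symbol_zero]
      rfl
  refine hfg.trans ?_
  by_cases h : α = β <;> simp [g, h]

variable (p n) in
theorem isFreeExtension_grPolynomials :
    IsFreeExtension (grPolynomials p n) (grBox (p := p) (n := n)) where
  mul_mem_span _ hs α := mul_grBox_mem_span hs α
  induction := gr_bernstein_induction
  -- Applying `grCoord β` to `∑ α, e_α a_α ∈ S` gives `a_β` on one side and `0` on the other.
  eq_zero a ha β := by
    have h := grCoord_of_mem ha β
    rw [map_sum] at h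
    simpa [grCoord_grBox_mul] using h

variable (p n) in
/-- The associated graded ring of the Bernstein filtration is left coherent. -/
theorem isLeftCoherent_gr_bernsteinFiltration : IsLeftCoherent (bernsteinFiltration p n).Gr := by
  refine (isFreeExtension_grPolynomials p n).isLeftCoherent (Fact.out : p.Prime).ne_zero ?_
  have h : ∀ k : ℕ, (k : (bernsteinFiltration p n).Gr) = (bernsteinFiltration p n).symbol 0 (k : FrobRing p n) ((bernsteinFiltration p n).natCast_mem k) := by
    intro k
    induction k with
    | zero =>
      rw [Nat.cast_zero, ← (bernsteinFiltration p n).symbol_zero 0]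
      exact (bernsteinFiltration p n).symbol_congr rfl Nat.cast_zero.symm
    | succ k ih =>
      rw [Nat.cast_succ, ih, ← (bernsteinFiltration p n).symbol_one, ← (bernsteinFiltration p n).symbol_add]
      exact (bernsteinFiltration p n).symbol_congr rfl (Nat.cast_succ k).symm
  rw [h, ← (bernsteinFiltration p n).symbol_zero 0]
  refine (bernsteinFiltration p n).symbol_congr rfl ?_
  rw [← map_natCast (algebraMap (ZMod p) (FrobRing p n)), ZMod.natCast_self, map_zero]

end Bernstein

end FrobFilt

theorem theorem4p12 (p n : ℕ) [Fact p.Prime] {M : Type*} [AddCommGroup M]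
    [Module (ZMod p) M] [Module (FrobFilt.FrobRing p n) M]
    [IsScalarTower (ZMod p) (FrobFilt.FrobRing p n) M]
    (S Ω : FrobFilt.ModuleFiltration (FrobFilt.bernsteinFiltration p n) M)
    (hS : S.IsGreat) (hΩ : Ω.IsGreat) (w : ℕ)
    (hSΩ : ∀ i, S.piece i ≤ Ω.piece i) (hΩS : ∀ i, Ω.piece i ≤ S.piece (i + w)) :
    (∀ a ≤ w, (S.interpolating Ω a).IsGreat) ∧
    ∀ a b : ℕ, a ≤ b → b ≤ w → ∀ k ≤ b - a,
      ((S.interpolating Ω a).grDiag (S.interpolating Ω b) k).IsFinitelyPresented ∧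
      ((S.interpolating Ω a).U (S.interpolating Ω b) (b - a) k).IsFinitelyPresented ∧
      ((S.interpolating Ω a).V (S.interpolating Ω b) k).IsFinitelyPresented := by
  have hW := FrobFilt.isLeftCoherent_gr_bernsteinFiltration p n
  have hT : ∀ a, (S.interpolating Ω a).IsGreat := fun a => hS.interpolating hW hΩ hSΩ a
  refine ⟨fun a _ => hT a, fun a b hab _ k hk => ?_⟩
  have hle : ∀ i, (S.interpolating Ω a).piece i ≤ (S.interpolating Ω b).piece i := fun i =>
    inf_le_inf (S.mono (by omega)) le_rfl
  -- The pair `T^a ⊆ T^b` satisfies the hypotheses originally imposed on `S ⊆ Ω`, so the comparison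
  -- is applied a second time.
  have key := FrobFilt.ModuleFiltration.isFinitelyPresented_subquotients hW hle (hT a).2 (hT b).2
  exact ⟨(key k).2.1, FrobFilt.ModuleFiltration.U_isFinitelyPresented hk (key (b - a - k)).1,
    (key k).2.2⟩
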